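/- Fix $d$ and, for each $n$, let $\mathcal{P}=\mathcal{P}_n$ be a family of distributions $P$ of $(X,Y,Z)\in\mathbb{R}\times\mathbb{R}\times\mathbb{R}^d$ such that $$Y=\beta_P X+\gamma_P^\top Z+\zeta_P,\qquad \mathbb{E}_P(\zeta_P\mid X,Z)=0 ,$$ for some $\beta_P\in\mathbb{R}$, $\gamma_P\in\mathbb{R}^d$. Assume that, with constants not depending on $n$ or $P$: (a) there are $C,\delta>0$ such that $\mathbb{E}_P(\|Z\|_\infty^{4+\delta})$, $\mathbb{E}_P(|Y|^{4+\delta})$ and $\mathbb{E}_P(|X|^{4+\delta})$ are at most $C$ for all $P\in\mathcal{P}$; (b) $\mathbb{E}_P(ZZ^\top)$ is invertible for all $P\in\mathcal{P}$ and, with $\eta_P:=\mathbb{E}_P(ZZ^\top)^{-1}\mathbb{E}_P(XZ)$, $\xi_P:=X-\eta_P^\top Z$, $\Theta_P:=\mathbb{E}_P(ZZ^\top\xi_P^2)$, $W:=(X,Z)$ and $\Sigma_P^{XZ}:=\mathbb{E}_P(WW^\top)$, there is $c>0$ such that $\mathrm{Var}_P(\zeta_P\mid X,Z)$ (almost surely),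 $\mathrm{Var}_P(\xi_P)$, $\lambda_{\min}(\Sigma_P^{XZ})$ and $\lambda_{\min}(\Theta_P)$ are at least $c$ for all $P\in\mathcal{P}$. Let $\mathcal{D}_1,\mathcal{D}_2$ be independent samples, each of $n$ independent observations from $P$. The projected covariance measure (PCM) with ordinary least squares (OLS) regressions (without intercept; any least squares solution may be used if it is not unique) and $\widehat v\equiv1$ is computed as follows. 1. On $\mathcal{D}_2$, regress $Y$ onto $(X,Z)$ to get $\widehat g$; let $\widetilde g$ be $\widehat g$ with its $Z$-component set to zero; regress $\widetilde g(X,Z)$ onto $Z$ to get $\widetilde m$. Put $\widetilde h(x,z):=\widetilde g(x,z)-\widetilde m(z)$, $\widehat\rho:=\frac1n\sum_{i\in\mathcal{D}_2}\{Y_i-\widehat g(X_i,Z_i)+\widetilde g(X_i,Z_i)-\widetilde m(Z_i)\}\widetilde h(X_i,Z_i)$, and $\widehat f=\widehat h:=\mathrm{sgn}(\widehat\rho)\,\widetilde h$, where $\mathrm{sgn}(0):=0$. 2. On $\mathcal{D}_1$, regress $\widehat f(X,Z)$ onto $Z$ to get $\widehat m_{\widehat f}$, and $Y$ onto $Z$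 to get $\widehat m$. For $i\in\mathcal{D}_1$ put $L_i:=\{Y_i-\widehat m(Z_i)\}\{\widehat f(X_i,Z_i)-\widehat m_{\widehat f}(Z_i)\}$ and $$T:=\frac{\frac1{\sqrt n}\sum_{i\in\mathcal{D}_1}L_i}{\sqrt{\frac1n\sum_{i\in\mathcal{D}_1}L_i^2-\bigl(\frac1n\sum_{i\in\mathcal{D}_1}L_i\bigr)^2}},$$ where a quotient with denominator $0$ is $0$. Let $z_{1-\alpha}$ be the $(1-\alpha)$-quantile of the standard normal distribution and $\mathcal{P}_1(\kappa):=\{P\in\mathcal{P}:|\beta_P|\ge\kappa/\sqrt n\}$. Then for every $\alpha\in(0,1)$, $$\lim_{\kappa\to\infty}\liminf_{n\to\infty}\inf_{P\in\mathcal{P}_1(\kappa)}\mathbb{P}_P(T>z_{1-\alpha}) =\lim_{\kappa\to\infty}\limsup_{n\to\infty}\inf_{P\in\mathcal{P}_1(\kappa)}\mathbb{P}_P(T>z_{1-\alpha})=1,$$ where the infimum over an empty family is $1$. -/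

import Mathlib

open MeasureTheory ProbabilityTheory Filter Topology
open scoped ENNReal

noncomputable section

/-- One observation `(X, Y, Z)`, with values in `ℝ × ℝ × ℝ^d`.  The norm of `Fin d → ℝ` is the
sup norm `‖·‖_∞`. -/
abbrev Obs (d : ℕ) : Type := ℝ × ℝ × (Fin d → ℝ)

namespace Obs

variable {d : ℕ}

/-- The coordinate `X`. -/
def X (o : Obs d) : ℝ := o.1

/-- The coordinate `Y`. -/
def Y (o : Obs d) : ℝ := o.2.1

/-- The coordinate `Z`. -/
def Z (o : Obs d) : Fin d → ℝ := o.2.2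

/-- The vector `W = (X, Z)` in `ℝ^(d+1)`, with `X` as its coordinate `0`. -/
def W (o : Obs d) : Fin (d + 1) → ℝ := Fin.cons o.X o.Z

/-- The σ-algebra generated by `(X, Z)`. -/
abbrev sigmaXZ (d : ℕ) : MeasurableSpace (Obs d) :=
  MeasurableSpace.comap (fun o : Obs d => (o.X, o.Z)) inferInstance

end Obs

namespace PCM

/-! ### The family of distributions -/

section Model

variable {d : ℕ}

/-- The noise `ζ = Y - b X - gᵀ Z`. -/
def noise (b : ℝ) (g : Fin d → ℝ) (o : Obs d) : ℝ := o.Y - b * o.X - g ⬝ᵥ o.Z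

/-- Under `P`, `Y = b X + gᵀ Z + ζ` with `E(ζ | X, Z) = 0`. -/
def IsLinearModel (P : Measure (Obs d)) (b : ℝ) (g : Fin d → ℝ) : Prop :=
  Integrable (noise b g) P ∧ P[noise b g | Obs.sigmaXZ d] =ᵐ[P] 0

/-- The moments of order `4 + δ` of `‖Z‖_∞`, `|Y|` and `|X|` are at most `C`. -/
def MomentBound (C δ : ℝ) (P : Measure (Obs d)) : Prop :=
  (∫⁻ o, ‖o.Z‖ₑ ^ (4 + δ) ∂P) ≤ ENNReal.ofReal C ∧
  (∫⁻ o, ‖o.Y‖ₑ ^ (4 + δ) ∂P) ≤ ENNReal.ofReal C ∧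
  (∫⁻ o, ‖o.X‖ₑ ^ (4 + δ) ∂P) ≤ ENNReal.ofReal C

/-- `E(ZZᵀ)`. -/
def sigmaZ (P : Measure (Obs d)) : Matrix (Fin d) (Fin d) ℝ :=
  Matrix.of fun i j => ∫ o, o.Z i * o.Z j ∂P

/-- `η_P = E(ZZᵀ)⁻¹ E(XZ)`. -/
def eta (P : Measure (Obs d)) : Fin d → ℝ :=
  (sigmaZ P)⁻¹.mulVec fun i => ∫ o, o.X * o.Z i ∂P

/-- `ξ_P = X - η_Pᵀ Z`. -/
def xi (P : Measure (Obs d)) (o : Obs d) : ℝ := o.X - eta P ⬝ᵥ o.Z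

/-- `Θ_P = E(ZZᵀ ξ_P²)`. -/
def theta (P : Measure (Obs d)) : Matrix (Fin d) (Fin d) ℝ :=
  Matrix.of fun i j => ∫ o, o.Z i * o.Z j * xi P o ^ 2 ∂P

/-- `Σ_P^{XZ} = E(WWᵀ)`. -/
def sigmaXZ (P : Measure (Obs d)) : Matrix (Fin (d + 1)) (Fin (d + 1)) ℝ :=
  Matrix.of fun i j => ∫ o, o.W i * o.W j ∂P

/-- `λ_min(A) ≥ c`: every eigenvalue of `A` is at least `c`. -/
def MinEigenvalueGE {k : ℕ} (A : Matrix (Fin k) (Fin k) ℝ) (c : ℝ) : Prop :=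
  ∀ μ : ℝ, Module.End.HasEigenvalue (Matrix.toLin' A) μ → c ≤ μ

/-- `E(ZZᵀ)` is invertible, and each of `Var(ζ | X, Z)` (almost surely), `Var(ξ)`,
`λ_min(Σ^{XZ})` and `λ_min(Θ)` is at least `c`. -/
structure NondegeneracyBound (c : ℝ) (P : Measure (Obs d)) (b : ℝ) (g : Fin d → ℝ) : Prop where
  isUnit_sigmaZ : IsUnit (sigmaZ P)
  condVar_noise : ∀ᵐ o ∂P, c ≤ (Var[noise b g; P | Obs.sigmaXZ d]) o
  var_xi : c ≤ Var[xi P; P]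
  eig_sigmaXZ : MinEigenvalueGE (sigmaXZ P) c
  eig_theta : MinEigenvalueGE (theta P) c

end Model

/-! ### Ordinary least squares -/

/-- `b` minimises the residual sum of squares of the regression of the responses `y i` onto the
covariate vectors `V i` (without intercept). -/
def IsLeastSquares {n k : ℕ} (V : Fin n → Fin k → ℝ) (y : Fin n → ℝ) (b : Fin k → ℝ) : Prop :=
  ∀ b' : Fin k → ℝ, ∑ i, (y i - b ⬝ᵥ V i) ^ 2 ≤ ∑ i, (y i - b' ⬝ᵥ V i) ^ 2

/-- A version of the ordinary least squares estimator: for all data it returns a least squares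
coefficient vector.  Two versions differ only at rank-deficient designs, where the minimiser is
not unique. -/
structure OLS where
  coef : {n k : ℕ} → (Fin n → Fin k → ℝ) → (Fin n → ℝ) → Fin k → ℝ
  isLeastSquares : ∀ {n k : ℕ} (V : Fin n → Fin k → ℝ) (y : Fin n → ℝ),
    IsLeastSquares V y (coef V y)

/-! ### The projected covariance measure with OLS regressions and `v̂ ≡ 1`

`D₁` and `D₂` are the two halves of the sample. -/

section Algorithm

variable {d n : ℕ} (ols : OLS) (D₁ D₂ : Fin n → Obs d)

/-- The regression of `Y` onto `(X, Z)` on `D₂`: coefficients of `ĝ`. -/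
def gCoef : Fin (d + 1) → ℝ := ols.coef (fun i => (D₂ i).W) (fun i => (D₂ i).Y)

/-- `ĝ`. -/
def gHat (o : Obs d) : ℝ := gCoef ols D₂ ⬝ᵥ o.W

/-- `g̃`: the function `ĝ` with its components that involve only `Z` set to zero. -/
def gTilde (o : Obs d) : ℝ := gCoef ols D₂ 0 * o.X

/-- `m̃`: the regression of `g̃(X, Z)` onto `Z` on `D₂`. -/
def mTilde (o : Obs d) : ℝ :=
  ols.coef (fun i => (D₂ i).Z) (fun i => gTilde ols D₂ (D₂ i)) ⬝ᵥ o.Z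

/-- `h̃ = g̃ - m̃`. -/
def hTilde (o : Obs d) : ℝ := gTilde ols D₂ o - mTilde ols D₂ o

/-- `ρ̂`. -/
def rhoHat : ℝ :=
  (1 / (n : ℝ)) * ∑ i, ((D₂ i).Y - gHat ols D₂ (D₂ i) + gTilde ols D₂ (D₂ i)
    - mTilde ols D₂ (D₂ i)) * hTilde ols D₂ (D₂ i)

/-- `ĥ = sgn(ρ̂) h̃`, with `sgn(0) = 0`. -/
def hHat (o : Obs d) : ℝ := Real.sign (rhoHat ols D₂) * hTilde ols D₂ o

/-- `v̂ ≡ 1`. -/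
def vHat (_o : Obs d) : ℝ := 1

/-- `f̂ = ĥ / v̂`. -/
def fHat (o : Obs d) : ℝ := hHat ols D₂ o / vHat o

/-- `m̂_f̂`: the regression of `f̂(X, Z)` onto `Z` on `D₁`. -/
def mHatF (o : Obs d) : ℝ :=
  ols.coef (fun i => (D₁ i).Z) (fun i => fHat ols D₂ (D₁ i)) ⬝ᵥ o.Z

/-- `m̂`: the regression of `Y` onto `Z` on `D₁`. -/
def mHat (o : Obs d) : ℝ :=
  ols.coef (fun i => (D₁ i).Z) (fun i => (D₁ i).Y) ⬝ᵥ o.Z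

/-- `L_i = (Y_i - m̂(Z_i)) (f̂(X_i, Z_i) - m̂_f̂(Z_i))`. -/
def L (i : Fin n) : ℝ :=
  ((D₁ i).Y - mHat ols D₁ (D₁ i)) * (fHat ols D₂ (D₁ i) - mHatF ols D₁ D₂ (D₁ i))

/-- The test statistic: the normalised sum of the `L_i` over their empirical standard deviation,
with `0 / 0 = 0`. -/
def T : ℝ :=
  (1 / √(n : ℝ) * ∑ i, L ols D₁ D₂ i) /
    √(1 / (n : ℝ) * ∑ i, L ols D₁ D₂ i ^ 2 - (1 / (n : ℝ) * ∑ i, L ols D₁ D₂ i) ^ 2)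

end Algorithm

/-! ### Power -/

/-- The `p`-th quantile `z_p` of the standard normal distribution. -/
def normalQuantile (p : ℝ) : ℝ := sInf {x : ℝ | p ≤ cdf (gaussianReal 0 1) x}

/-- `ℙ_P(T > z_{1-α})` for two independent samples, each of `n` independent observations
from `P`. -/
def power {d : ℕ} (ols : OLS) (α : ℝ) (n : ℕ) (P : ProbabilityMeasure (Obs d)) : ℝ≥0∞ :=
  ((Measure.pi fun _ : Fin n => (P : Measure (Obs d))).prod
    (Measure.pi fun _ : Fin n => (P : Measure (Obs d))))
      {D : (Fin n → Obs d) × (Fin n → Obs d) | normalQuantile (1 - α) < T ols D.1 D.2}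

/-- `fam₁(κ) = {P ∈ fam : |β_P| ≥ κ / √n}`. -/
def alternatives {d : ℕ} (fam : Set (ProbabilityMeasure (Obs d)))
    (β : ProbabilityMeasure (Obs d) → ℝ) (n : ℕ) (κ : ℝ) : Set (ProbabilityMeasure (Obs d)) :=
  {P ∈ fam | κ / √(n : ℝ) ≤ |β P|}

/-- The infimum over `fam₁(κ)` of the power.  It is taken in `[0, 1]`, so that it is `1` if there is
no alternative. -/
def worstPower {d : ℕ} (ols : OLS) (α : ℝ) (fam : Set (ProbabilityMeasure (Obs d)))
    (β : ProbabilityMeasure (Obs d) → ℝ) (n : ℕ) (κ : ℝ) : ℝ≥0∞ :=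
  1 ⊓ ⨅ P ∈ alternatives fam β n κ, power ols α n P

end PCM

end

noncomputable section

namespace PCM

/-! ### Least squares -/

section LeastSquares

variable {n k : ℕ} {V : Fin n → Fin k → ℝ}

/-! Algebra first. All regressions on `Z` are linear, so by the normal equations `h̃` on `D₂` and
the residual of `f̂` on `D₁` are multiples of the residual `resX` of `X` on `Z`. The residual of `ĝ`
is orthogonal to `h̃`, hence `ρ̂` is the mean square of `h̃` (`rhoHat_eq`) and its sign is `1`
outside degenerate cases. The scale of `f̂` cancels in the studentised statistic: `T` is the sign of
the estimated coefficient of `X` on `D₂`, times `√n` times the empirical covariance of the residuals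
of `X` and `Y` on `D₁`, over the sample standard deviation of their products (`T_eq`).

That covariance is `β` times the mean square of `resX`, plus a noise term of order `1 / √n`
(`avg_Y_mul_resX`). If `|β| ≥ κ / √n`, the signal is at least a constant times `κ / √n`. For large
`κ` it dominates the noise on both samples: `D₂` then yields the sign of `β`, and on `D₁` the
numerator exceeds any prescribed constant. The denominator is bounded, so `T` exceeds a fixed
critical value; no limiting distribution is needed. This is the deterministic statement
`exists_forall_lt_T`, valid on samples satisfying `IsRegular`.

It remains to show that samples are regular with probability near one, uniformly over the family
(`withHighProb_isRegular`). Chebyshev and Markov suffice for most conditions, with coefficients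
bounded uniformly by `HasMoments.isBoundedModel`. The delicate condition is the lower bound on the
sample variance of the score `(b ξ + ζ) ξ`: its square has no second moment under the assumptions.
Truncation is a contraction and so can only lower the sample variance; the truncated score obeys
Chebyshev, and `δ > 0` makes the loss of population variance uniformly small
(`withHighProb_variance_score`). -/

/-- The normal equations. -/
theorem IsLeastSquares.sum_residual_mul_eq_zero {y : Fin n → ℝ} {b : Fin k → ℝ}
    (h : IsLeastSquares V y b) (u : Fin k → ℝ) :
    ∑ i, (y i - b ⬝ᵥ V i) * (u ⬝ᵥ V i) = 0 := by
  set A := ∑ i, (y i - b ⬝ᵥ V i) * (u ⬝ᵥ V i) with hA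
  set B := ∑ i, (u ⬝ᵥ V i) ^ 2 with hB
  have hB0 : 0 ≤ B := Finset.sum_nonneg fun i _ => sq_nonneg _
  have key (t : ℝ) : 0 ≤ -2 * t * A + t ^ 2 * B := by
    have h1 := h (b + t • u)
    have h2 : ∑ i, (y i - (b + t • u) ⬝ᵥ V i) ^ 2
        = ∑ i, (y i - b ⬝ᵥ V i) ^ 2 + (-2 * t * A + t ^ 2 * B) := by
      rw [hA, hB, Finset.mul_sum, Finset.mul_sum, ← Finset.sum_add_distrib,
        ← Finset.sum_add_distrib]
      refine Finset.sum_congr rfl fun i _ => ?_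
      rw [add_dotProduct, smul_dotProduct, smul_eq_mul]
      ring
    linarith
  -- The exact minimiser of the quadratic is `A / B`; the `+ 1` spares the case `B = 0` and still
  -- gives a negative value unless `A = 0`.
  have h3 := key (A / (B + 1))
  have h4 : -2 * (A / (B + 1)) * A + (A / (B + 1)) ^ 2 * B
      = -(A ^ 2 * (B + 2)) / (B + 1) ^ 2 := by
    field_simp
    ring
  rw [h4, le_div_iff₀ (by positivity)] at h3
  nlinarith [sq_nonneg A, mul_nonneg (sq_nonneg A) hB0]

/-- Two residual vectors of regressions onto `V` agree up to the factor `s` if the responses do up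
to a linear combination of the covariates. -/
theorem residual_eq_mul {r r' : Fin n → ℝ} (s : ℝ) (a : Fin k → ℝ)
    (hr : ∀ u : Fin k → ℝ, ∑ i, r i * (u ⬝ᵥ V i) = 0)
    (hr' : ∀ u : Fin k → ℝ, ∑ i, r' i * (u ⬝ᵥ V i) = 0)
    (h : ∀ i, r' i - s * r i = a ⬝ᵥ V i) (i : Fin n) : r' i = s * r i := by
  -- The difference `r' - s r` is both a combination of the covariates and orthogonal to all of
  -- them. This determines the residuals at the sample points even if the coefficients are not
  -- unique.
  have h0 : ∑ i, (r' i - s * r i) ^ 2 = 0 := by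
    calc ∑ i, (r' i - s * r i) ^ 2
        = ∑ i, r' i * (a ⬝ᵥ V i) - s * ∑ i, r i * (a ⬝ᵥ V i) := by
          rw [Finset.mul_sum, ← Finset.sum_sub_distrib]
          refine Finset.sum_congr rfl fun i _ => ?_
          rw [← h i]
          ring
      _ = 0 := by rw [hr, hr']; ring
  have h1 := (Finset.sum_eq_zero_iff_of_nonneg fun i _ => sq_nonneg (r' i - s * r i)).1 h0 i
    (Finset.mem_univ i)
  have h2 := pow_eq_zero_iff (two_ne_zero) |>.1 h1
  linarith

end LeastSquares

/-! ### Empirical means -/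

section Avg

variable {n : ℕ} {α : Type*}

/-- The empirical mean of `f` over the sample `D`. -/
def avg (D : Fin n → α) (f : α → ℝ) : ℝ := (1 / (n : ℝ)) * ∑ i, f (D i)

variable (D : Fin n → α) (f g : α → ℝ)

theorem avg_add : avg D (fun o => f o + g o) = avg D f + avg D g := by
  simp only [avg, Finset.sum_add_distrib, mul_add]

theorem avg_sub : avg D (fun o => f o - g o) = avg D f - avg D g := by
  simp only [avg, Finset.sum_sub_distrib, mul_sub]

theorem avg_const_mul (s : ℝ) : avg D (fun o => s * f o) = s * avg D f := by
  simp only [avg, ← Finset.mul_sum]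
  ring

theorem avg_finset_sum {ι : Type*} (s : Finset ι) (F : ι → α → ℝ) :
    avg D (fun o => ∑ j ∈ s, F j o) = ∑ j ∈ s, avg D (F j) := by
  simp only [avg, ← Finset.mul_sum]
  rw [Finset.sum_comm]

theorem avg_const (hn : n ≠ 0) (s : ℝ) : avg D (fun _ => s) = s := by
  simp [avg, hn]

variable {f g}

theorem avg_mono (h : ∀ o, f o ≤ g o) : avg D f ≤ avg D g :=
  mul_le_mul_of_nonneg_left (Finset.sum_le_sum fun i _ => h (D i)) (by positivity)

theorem avg_nonneg (h : ∀ o, 0 ≤ f o) : 0 ≤ avg D f :=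
  mul_nonneg (by positivity) (Finset.sum_nonneg fun i _ => h (D i))

theorem avg_congr (h : ∀ o, f o = g o) : avg D f = avg D g := by
  rw [funext h]

variable (f) in
/-- The sample variance is at most the empirical mean square deviation from any point. -/
theorem avg_sq_sub_sq_avg_le (hn : n ≠ 0) (m : ℝ) :
    avg D (fun o => f o ^ 2) - avg D f ^ 2 ≤ avg D (fun o => (f o - m) ^ 2) := by
  have h : avg D (fun o => (f o - m) ^ 2)
      = avg D (fun o => f o ^ 2) - 2 * m * avg D f + m ^ 2 := by
    rw [← avg_const_mul, ← avg_sub, ← avg_const D hn (m ^ 2), ← avg_add]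
    exact avg_congr D fun o => by ring
  rw [h]
  nlinarith [sq_nonneg (avg D f - m)]

variable (f) in
/-- The sample variance as a mean square deviation. -/
theorem avg_sq_sub_sq_avg (hn : n ≠ 0) :
    avg D (fun o => f o ^ 2) - avg D f ^ 2 = avg D (fun o => (f o - avg D f) ^ 2) := by
  have h : avg D (fun o => (f o - avg D f) ^ 2)
      = avg D (fun o => f o ^ 2) - 2 * avg D f * avg D f + avg D f ^ 2 := by
    rw [← avg_const_mul, ← avg_sub]
    conv_rhs => rw [← avg_const D hn (avg D f ^ 2), ← avg_add]
    exact avg_congr D fun o => by ring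
  rw [h]
  ring

end Avg

/-! ### The statistic in terms of residuals -/

section Residuals

variable {d n : ℕ} (ols : OLS) (D D₁ D₂ : Fin n → Obs d)

/-- The residual of the regression of `X` onto `Z` on `D`. -/
def resX (o : Obs d) : ℝ := o.X - ols.coef (fun i => (D i).Z) (fun i => (D i).X) ⬝ᵥ o.Z

/-- The residual of the regression of `Y` onto `Z` on `D`. -/
def resY (o : Obs d) : ℝ := o.Y - ols.coef (fun i => (D i).Z) (fun i => (D i).Y) ⬝ᵥ o.Z

theorem avg_resX_mul (u : Fin d → ℝ) : avg D (fun o => resX ols D o * (u ⬝ᵥ o.Z)) = 0 := by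
  have h := (ols.isLeastSquares (fun i => (D i).Z)
    (fun i => (D i).X)).sum_residual_mul_eq_zero u
  simp only [avg, resX, h, mul_zero]

theorem avg_resY_mul (u : Fin d → ℝ) : avg D (fun o => resY ols D o * (u ⬝ᵥ o.Z)) = 0 := by
  have h := (ols.isLeastSquares (fun i => (D i).Z)
    (fun i => (D i).Y)).sum_residual_mul_eq_zero u
  simp only [avg, resY, h, mul_zero]

theorem sum_eq_zero_of_avg {f : Obs d → ℝ} (h : avg D f = 0) : ∑ i, f (D i) = 0 := by
  rcases Nat.eq_zero_or_pos n with rfl | hn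
  · simp
  · rw [avg, mul_eq_zero] at h
    refine h.resolve_left ?_
    positivity

theorem dotProduct_W (u : Fin (d + 1) → ℝ) (o : Obs d) :
    u ⬝ᵥ o.W = u 0 * o.X + Fin.tail u ⬝ᵥ o.Z := by
  simp [dotProduct, Fin.sum_univ_succ, Obs.W, Fin.tail]

/-- `h̃` is on `D₂` a multiple of the residual of `X`. -/
theorem hTilde_eq (i : Fin n) :
    hTilde ols D (D i) = gCoef ols D 0 * resX ols D (D i) := by
  have h := (ols.isLeastSquares (fun i => (D i).Z)
    (fun i => gTilde ols D (D i))).sum_residual_mul_eq_zero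
  refine residual_eq_mul (V := fun i => (D i).Z) (r := fun i => resX ols D (D i))
    (r' := fun i => hTilde ols D (D i)) (gCoef ols D 0)
    (gCoef ols D 0 • ols.coef (fun i => (D i).Z) (fun i => (D i).X)
      - ols.coef (fun i => (D i).Z) (fun i => gTilde ols D (D i)))
    (fun u => sum_eq_zero_of_avg D (avg_resX_mul ols D u)) h (fun i => ?_) i
  simp only [hTilde, gTilde, mTilde, resX, sub_dotProduct, smul_dotProduct, smul_eq_mul]
  ring

/-- The residual of `f̂` on `D₁` is a multiple of the residual of `X`. -/
theorem fHat_sub_mHatF (i : Fin n) :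
    fHat ols D₂ (D₁ i) - mHatF ols D₁ D₂ (D₁ i)
      = Real.sign (rhoHat ols D₂) * gCoef ols D₂ 0 * resX ols D₁ (D₁ i) := by
  have h := (ols.isLeastSquares (fun i => (D₁ i).Z)
    (fun i => fHat ols D₂ (D₁ i))).sum_residual_mul_eq_zero
  refine residual_eq_mul (V := fun i => (D₁ i).Z) (r := fun i => resX ols D₁ (D₁ i))
    (r' := fun i => fHat ols D₂ (D₁ i) - mHatF ols D₁ D₂ (D₁ i))
    (Real.sign (rhoHat ols D₂) * gCoef ols D₂ 0)
    -- The part `m̃` fitted on `D₂` is linear in `Z`, so the regression on `D₁` absorbs it.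
    ((Real.sign (rhoHat ols D₂) * gCoef ols D₂ 0) •
        ols.coef (fun i => (D₁ i).Z) (fun i => (D₁ i).X)
      - Real.sign (rhoHat ols D₂) • ols.coef (fun i => (D₂ i).Z) (fun i => gTilde ols D₂ (D₂ i))
      - ols.coef (fun i => (D₁ i).Z) (fun i => fHat ols D₂ (D₁ i)))
    (fun u => sum_eq_zero_of_avg D₁ (avg_resX_mul ols D₁ u)) h (fun i => ?_) i
  simp only [sub_dotProduct, smul_dotProduct, smul_eq_mul, resX, mHatF]
  simp only [fHat, hHat, vHat, hTilde, gTilde, mTilde]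
  ring

/-- The sample `D₂` enters only through a scalar common to all `i`, which is why only its sign
survives studentisation. -/
theorem L_eq (i : Fin n) :
    L ols D₁ D₂ i = Real.sign (rhoHat ols D₂) * gCoef ols D₂ 0
      * (resX ols D₁ (D₁ i) * resY ols D₁ (D₁ i)) := by
  rw [L, fHat_sub_mHatF, mHat, resY]
  ring

theorem sum_gHat_residual_mul (u : Fin (d + 1) → ℝ) :
    ∑ i, ((D i).Y - gHat ols D (D i)) * (u ⬝ᵥ (D i).W) = 0 :=
  (ols.isLeastSquares (fun i => (D i).W) (fun i => (D i).Y)).sum_residual_mul_eq_zero u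

theorem avg_X_mul_resX :
    avg D (fun o => o.X * resX ols D o) = avg D (fun o => resX ols D o ^ 2) := by
  have h := avg_resX_mul ols D (ols.coef (fun i => (D i).Z) (fun i => (D i).X))
  rw [← sub_eq_zero, ← avg_sub, ← h]
  refine avg_congr D fun o => ?_
  conv_lhs => rw [resX]
  conv_rhs => rw [resX]
  ring

/-- The partialling-out formula for the coefficient of `X` in the regression of `Y` onto
`(X, Z)`. -/
theorem gCoef_mul_avg :
    gCoef ols D 0 * avg D (fun o => resX ols D o ^ 2) = avg D (fun o => o.Y * resX ols D o) := by
  -- The test direction is chosen so that its product with `W` is the residual of `X`.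
  have h := sum_gHat_residual_mul ols D
    (Fin.cons 1 (-ols.coef (fun i => (D i).Z) (fun i => (D i).X)))
  have h1 : avg D (fun o => (o.Y - gHat ols D o) * resX ols D o) = 0 := by
    rw [avg, ← mul_zero (1 / (n : ℝ)), ← h]
    congr 1
    refine Finset.sum_congr rfl fun i _ => ?_
    rw [dotProduct_W, Fin.cons_zero, Fin.tail_cons, resX, neg_dotProduct]
    ring
  have h2 := avg_resX_mul ols D (Fin.tail (gCoef ols D))
  have h3 : avg D (fun o => o.Y * resX ols D o)
      = avg D (fun o => (o.Y - gHat ols D o) * resX ols D o)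
        + (gCoef ols D 0 * avg D (fun o => o.X * resX ols D o)
          + avg D (fun o => resX ols D o * (Fin.tail (gCoef ols D) ⬝ᵥ o.Z))) := by
    rw [← avg_const_mul, ← avg_add, ← avg_add]
    refine avg_congr D fun o => ?_
    rw [gHat, dotProduct_W]
    ring
  rw [h3, h1, h2, avg_X_mul_resX]
  ring

/-- The residual of `Y` on `(X, Z)` is orthogonal to `h̃`, a combination of `X` and `Z`; what
remains is the mean square of `h̃`. In particular `ρ̂` is never negative. -/
theorem rhoHat_eq :
    rhoHat ols D = gCoef ols D 0 ^ 2 * avg D (fun o => resX ols D o ^ 2) := by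
  have h := sum_gHat_residual_mul ols D (Fin.cons (gCoef ols D 0)
    (-(gCoef ols D 0 • ols.coef (fun i => (D i).Z) (fun i => (D i).X))))
  rw [← avg_const_mul, rhoHat, avg]
  congr 1
  rw [← sub_eq_zero, ← Finset.sum_sub_distrib, ← h]
  refine Finset.sum_congr rfl fun i _ => ?_
  have h1 := hTilde_eq ols D i
  have h2 : (D i).Y - gHat ols D (D i) + gTilde ols D (D i) - mTilde ols D (D i)
      = (D i).Y - gHat ols D (D i) + hTilde ols D (D i) := by
    rw [hTilde]
    ring
  rw [h2, h1, dotProduct_W, Fin.cons_zero, Fin.tail_cons, neg_dotProduct, smul_dotProduct,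
    smul_eq_mul]
  simp only [resX]
  ring

theorem avg_resX_mul_resY :
    avg D (fun o => resX ols D o * resY ols D o) = avg D (fun o => o.Y * resX ols D o) := by
  have h := avg_resX_mul ols D (ols.coef (fun i => (D i).Z) (fun i => (D i).Y))
  rw [eq_comm, ← sub_eq_zero, ← avg_sub, ← h]
  refine avg_congr D fun o => ?_
  rw [resY]
  ring

/-- The test statistic in terms of the residuals of `X` and `Y` on `D₁`. -/
theorem T_eq (hn : n ≠ 0) (hb : gCoef ols D₂ 0 ≠ 0)
    (hS : 0 < avg D₂ (fun o => resX ols D₂ o ^ 2)) :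
    T ols D₁ D₂ = gCoef ols D₂ 0 / |gCoef ols D₂ 0| *
      (√n * avg D₁ (fun o => resX ols D₁ o * resY ols D₁ o) /
        √(avg D₁ (fun o => (resX ols D₁ o * resY ols D₁ o) ^ 2)
          - avg D₁ (fun o => resX ols D₁ o * resY ols D₁ o) ^ 2)) := by
  have hsign : Real.sign (rhoHat ols D₂) = 1 := by
    rw [rhoHat_eq]
    exact Real.sign_of_pos (by positivity)
  set b := gCoef ols D₂ 0 with hbdef
  set f : Obs d → ℝ := fun o => resX ols D₁ o * resY ols D₁ o with hf
  have hL (i : Fin n) : L ols D₁ D₂ i = b * f (D₁ i) := by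
    rw [L_eq, hsign, one_mul]
  have hn0 : (0 : ℝ) < n := by positivity
  have h1 : 1 / √(n : ℝ) * ∑ i, L ols D₁ D₂ i = b * (√n * avg D₁ f) := by
    have hs : √(n : ℝ) * √n = n := Real.mul_self_sqrt hn0.le
    have hs0 : (0 : ℝ) < √n := Real.sqrt_pos.2 hn0
    have hs1 : 1 / √(n : ℝ) = √n * (1 / n) := by
      rw [div_eq_iff hs0.ne', mul_right_comm, hs, mul_one_div_cancel hn0.ne']
    simp only [hL, ← Finset.mul_sum, avg, hs1]
    ring
  have h2 : 1 / (n : ℝ) * ∑ i, L ols D₁ D₂ i ^ 2 - (1 / (n : ℝ) * ∑ i, L ols D₁ D₂ i) ^ 2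
      = b ^ 2 * (avg D₁ (fun o => f o ^ 2) - avg D₁ f ^ 2) := by
    simp only [hL, ← Finset.mul_sum, avg, mul_pow]
    ring
  rw [T, h1, h2, Real.sqrt_mul (sq_nonneg b), Real.sqrt_sq_eq_abs, mul_div_mul_comm]

end Residuals

/-! ### Regular samples -/

section Regular

variable {d n : ℕ}

/-- The limit `(b ξ + ζ) ξ` of the products of the residuals of `X` and `Y`. -/
def score (P : Measure (Obs d)) (b : ℝ) (g : Fin d → ℝ) (o : Obs d) : ℝ :=
  (b * xi P o + noise b g o) * xi P o

/-- The sample `D` has the empirical moments that are expected under `P`, up to constants. -/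
structure IsRegular (c v K : ℝ) (P : Measure (Obs d)) (b : ℝ) (g : Fin d → ℝ)
    (D : Fin n → Obs d) : Prop where
  gram : ∀ u : Fin d → ℝ, c / 2 * ∑ j, u j ^ 2 ≤ avg D (fun o => (u ⬝ᵥ o.Z) ^ 2)
  Z_mul_xi : ∀ j, |avg D (fun o => o.Z j * xi P o)| ≤ K / √n
  Z_mul_noise : ∀ j, |avg D (fun o => o.Z j * noise b g o)| ≤ K / √n
  xi_mul_noise : |avg D (fun o => xi P o * noise b g o)| ≤ K / √n
  xi_sq : c / 2 ≤ avg D (fun o => xi P o ^ 2)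
  norm_pow_four : avg D (fun o => ‖o‖ ^ 4) ≤ K
  variance_score : v ≤ avg D (fun o => score P b g o ^ 2) - avg D (score P b g) ^ 2

/-- The observations and the regression coefficients are controlled by the constant `A`. -/
structure IsBoundedModel (A : ℝ) (P : Measure (Obs d)) (b : ℝ) (g : Fin d → ℝ) : Prop where
  abs_coef : |b| ≤ A
  abs_xi : ∀ o, |xi P o| ≤ A * ‖o‖
  abs_noise : ∀ o, |noise b g o| ≤ A * ‖o‖

theorem abs_Z_le (o : Obs d) (j : Fin d) : |o.Z j| ≤ ‖o‖ :=
  (norm_le_pi_norm o.Z j).trans ((norm_snd_le o.2).trans (norm_snd_le o))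

theorem abs_X_le (o : Obs d) : |o.X| ≤ ‖o‖ := norm_fst_le o

theorem abs_Y_le (o : Obs d) : |o.Y| ≤ ‖o‖ := (norm_fst_le o.2).trans (norm_snd_le o)

theorem abs_dotProduct_Z_le (u : Fin d → ℝ) (o : Obs d) :
    |u ⬝ᵥ o.Z| ≤ (∑ j, |u j|) * ‖o‖ := by
  rw [dotProduct, Finset.sum_mul]
  refine (Finset.abs_sum_le_sum_abs _ _).trans (Finset.sum_le_sum fun j _ => ?_)
  rw [abs_mul]
  exact mul_le_mul_of_nonneg_left (abs_Z_le o j) (abs_nonneg _)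

theorem avg_mul_dotProduct (D : Fin n → Obs d) (w : Obs d → ℝ) (u : Fin d → ℝ) :
    avg D (fun o => w o * (u ⬝ᵥ o.Z)) = ∑ j, u j * avg D (fun o => o.Z j * w o) := by
  simp only [← avg_const_mul]
  rw [← avg_finset_sum]
  refine avg_congr D fun o => ?_
  rw [dotProduct, Finset.mul_sum]
  exact Finset.sum_congr rfl fun j _ => by ring

theorem abs_avg_mul_dotProduct_le {D : Fin n → Obs d} {w : Obs d → ℝ} {κ : ℝ} (u : Fin d → ℝ)
    (hw : ∀ j, |avg D (fun o => o.Z j * w o)| ≤ κ) :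
    |avg D (fun o => w o * (u ⬝ᵥ o.Z))| ≤ (∑ j, |u j|) * κ := by
  rw [avg_mul_dotProduct, Finset.sum_mul]
  refine (Finset.abs_sum_le_sum_abs _ _).trans (Finset.sum_le_sum fun j _ => ?_)
  rw [abs_mul]
  exact mul_le_mul_of_nonneg_left (hw j) (abs_nonneg _)

/-- The error of a least squares coefficient for responses `w` that are nearly uncorrelated with
the covariates. -/
theorem sum_abs_le_of_residual {D : Fin n → Obs d} {w : Obs d → ℝ} {c κ : ℝ} (hc : 0 < c)
    (hκ : 0 ≤ κ) {u : Fin d → ℝ}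
    (hgram : c / 2 * ∑ j, u j ^ 2 ≤ avg D (fun o => (u ⬝ᵥ o.Z) ^ 2))
    (hw : ∀ j, |avg D (fun o => o.Z j * w o)| ≤ κ)
    (hres : avg D (fun o => (w o - u ⬝ᵥ o.Z) * (u ⬝ᵥ o.Z)) = 0) :
    ∑ j, |u j| ≤ 2 * d * κ / c := by
  set s := ∑ j, |u j| with hs
  have hs0 : 0 ≤ s := Finset.sum_nonneg fun j _ => abs_nonneg _
  -- The left side is quadratic in `u` and bounded below by the Gram matrix, the right side is
  -- linear in `u`; cancelling one factor bounds `u`.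
  have h1 : avg D (fun o => (u ⬝ᵥ o.Z) ^ 2) = avg D (fun o => w o * (u ⬝ᵥ o.Z)) := by
    rw [eq_comm, ← sub_eq_zero, ← avg_sub, ← hres]
    exact avg_congr D fun o => by ring
  have h2 := (le_abs_self _).trans (abs_avg_mul_dotProduct_le u hw)
  have h3 : s ^ 2 ≤ d * ∑ j, u j ^ 2 := by
    have := sq_sum_le_card_mul_sum_sq (s := Finset.univ) (f := fun j => |u j|)
    simpa [sq_abs] using this
  have h4 : c / 2 * s ^ 2 ≤ d * κ * s := by
    calc c / 2 * s ^ 2 ≤ c / 2 * (d * ∑ j, u j ^ 2) := by gcongr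
      _ = d * (c / 2 * ∑ j, u j ^ 2) := by ring
      _ ≤ d * (s * κ) := mul_le_mul_of_nonneg_left (by linarith) (Nat.cast_nonneg d)
      _ = d * κ * s := by ring
  rcases hs0.eq_or_lt with h0 | h0
  · rw [← h0]
    positivity
  · rw [le_div_iff₀ hc]
    have : c / 2 * s ≤ d * κ := le_of_mul_le_mul_right (by linarith) h0
    linarith

variable {c v K A : ℝ} {P : Measure (Obs d)} {b : ℝ} {g : Fin d → ℝ} {D : Fin n → Obs d}

theorem Y_eq (b : ℝ) (g : Fin d → ℝ) (o : Obs d) : o.Y = b * o.X + g ⬝ᵥ o.Z + noise b g o := by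
  rw [noise]
  ring

theorem IsRegular.nonneg (h : IsRegular c v K P b g D) : 0 ≤ K :=
  (avg_nonneg D fun _ => by positivity).trans h.norm_pow_four

/-- The residual of `X` is `ξ` up to a small linear combination of the covariates. -/
theorem IsRegular.exists_resX_eq (ols : OLS) (hc : 0 < c) (h : IsRegular c v K P b g D) :
    ∃ u : Fin d → ℝ, ∑ j, |u j| ≤ 2 * d * K / c / √n ∧
      ∀ o, resX ols D o = xi P o - u ⬝ᵥ o.Z := by
  set u := ols.coef (fun i => (D i).Z) (fun i => (D i).X) - eta P with hu
  have hres (o : Obs d) : resX ols D o = xi P o - u ⬝ᵥ o.Z := by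
    rw [resX, xi, hu, sub_dotProduct]
    ring
  refine ⟨u, ?_, hres⟩
  have hK := h.nonneg
  have h1 := sum_abs_le_of_residual (w := xi P) hc (by positivity) (h.gram u) h.Z_mul_xi
    (by simp only [← hres, avg_resX_mul])
  calc _ ≤ _ := h1
    _ = _ := by ring

theorem IsRegular.abs_avg_Z_mul_le (h : IsRegular c v K P b g D) (hA : |b| ≤ A) (j : Fin d) :
    |avg D (fun o => o.Z j * (b * xi P o + noise b g o))| ≤ (A + 1) * K / √n := by
  have h1 : avg D (fun o => o.Z j * (b * xi P o + noise b g o))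
      = b * avg D (fun o => o.Z j * xi P o) + avg D (fun o => o.Z j * noise b g o) := by
    rw [← avg_const_mul, ← avg_add]
    exact avg_congr D fun o => by ring
  have hK := h.nonneg
  rw [h1]
  calc _ ≤ |b| * |avg D (fun o => o.Z j * xi P o)| + |avg D (fun o => o.Z j * noise b g o)| := by
        rw [← abs_mul]
        exact abs_add_le _ _
    _ ≤ A * (K / √n) + K / √n := by
        gcongr
        · exact (abs_nonneg b).trans hA
        · exact h.Z_mul_xi j
        · exact h.Z_mul_noise j
    _ = _ := by ring

/-- The residual of `Y` is `b ξ + ζ` up to a small linear combination of the covariates. -/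
theorem IsRegular.exists_resY_eq (ols : OLS) (hc : 0 < c) (h : IsRegular c v K P b g D)
    (hA : |b| ≤ A) :
    ∃ u : Fin d → ℝ, ∑ j, |u j| ≤ (A + 1) * (2 * d * K / c) / √n ∧
      ∀ o, resY ols D o = b * xi P o + noise b g o - u ⬝ᵥ o.Z := by
  -- The population coefficient of `Y` on `Z` is `g + b η`, because `Y = (g + b η)ᵀ Z + b ξ + ζ`.
  set u := ols.coef (fun i => (D i).Z) (fun i => (D i).Y) - g - b • eta P with hu
  have hres (o : Obs d) : resY ols D o = b * xi P o + noise b g o - u ⬝ᵥ o.Z := by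
    rw [resY, xi, noise, hu, sub_dotProduct, sub_dotProduct, smul_dotProduct, smul_eq_mul]
    ring
  refine ⟨u, ?_, hres⟩
  have hK := h.nonneg
  have hA0 : 0 ≤ A := (abs_nonneg b).trans hA
  have h1 := sum_abs_le_of_residual (w := fun o => b * xi P o + noise b g o) hc (by positivity)
    (h.gram u) (h.abs_avg_Z_mul_le hA) (by simp only [← hres, avg_resY_mul])
  calc _ ≤ _ := h1
    _ = _ := by ring

/-- Signal plus noise: the contribution of `gᵀ Z` vanishes by the normal equations. -/
theorem avg_Y_mul_resX (ols : OLS) (D : Fin n → Obs d) (b : ℝ) (g : Fin d → ℝ) :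
    avg D (fun o => o.Y * resX ols D o)
      = b * avg D (fun o => resX ols D o ^ 2) + avg D (fun o => noise b g o * resX ols D o) := by
  have h := avg_resX_mul ols D g
  rw [← avg_X_mul_resX, ← avg_const_mul, ← avg_add, ← sub_eq_zero, ← avg_sub, ← h]
  refine avg_congr D fun o => ?_
  rw [Y_eq b g]
  ring

theorem one_le_sqrt_natCast (hn : n ≠ 0) : 1 ≤ √(n : ℝ) := by
  rw [Real.one_le_sqrt]
  exact_mod_cast Nat.one_le_iff_ne_zero.2 hn

theorem div_sqrt_mul_div_sqrt (x y : ℝ) : x / √(n : ℝ) * (y / √n) = x * y / n := by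
  rw [div_mul_div_comm, Real.mul_self_sqrt (Nat.cast_nonneg n)]

/-- Since `resX = ξ - uᵀ Z` is orthogonal to `uᵀ Z`, the only correction to the mean of `ξ ^ 2` is
the mean of `ξ (uᵀ Z)`. It is a product of two factors of order `1 / √n`. -/
theorem IsRegular.le_avg_resX_sq (ols : OLS) (hc : 0 < c) (h : IsRegular c v K P b g D) :
    c / 2 - 2 * d * K / c * K / n ≤ avg D (fun o => resX ols D o ^ 2) := by
  obtain ⟨u, hu, hres⟩ := h.exists_resX_eq ols hc
  have h1 := abs_avg_mul_dotProduct_le u h.Z_mul_xi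
  have h2 : avg D (fun o => resX ols D o ^ 2)
      = avg D (fun o => xi P o ^ 2) - avg D (fun o => xi P o * (u ⬝ᵥ o.Z)) := by
    have h3 := avg_resX_mul ols D u
    rw [← avg_sub, ← sub_eq_zero, ← avg_sub, ← neg_eq_zero, ← h3, ← neg_one_mul, ← avg_const_mul]
    refine avg_congr D fun o => ?_
    rw [hres]
    ring
  have hK := h.nonneg
  have h4 : (∑ j, |u j|) * (K / √n) ≤ 2 * d * K / c * K / n := by
    rw [← div_sqrt_mul_div_sqrt]
    gcongr
  have := h.xi_sq
  have := (abs_le.1 h1).2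
  linarith

theorem IsRegular.abs_avg_noise_mul_resX_le (ols : OLS) (hc : 0 < c) (hn : n ≠ 0)
    (h : IsRegular c v K P b g D) :
    |avg D (fun o => noise b g o * resX ols D o)| ≤ (K + 2 * d * K / c * K) / √n := by
  obtain ⟨u, hu, hres⟩ := h.exists_resX_eq ols hc
  have h1 := abs_avg_mul_dotProduct_le u h.Z_mul_noise
  have h2 : avg D (fun o => noise b g o * resX ols D o)
      = avg D (fun o => xi P o * noise b g o) - avg D (fun o => noise b g o * (u ⬝ᵥ o.Z)) := by
    rw [← avg_sub]
    refine avg_congr D fun o => ?_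
    rw [hres]
    ring
  have hK := h.nonneg
  have h4 : (∑ j, |u j|) * (K / √n) ≤ 2 * d * K / c * (K / √n) := by
    gcongr
    refine hu.trans (div_le_self (by positivity) (one_le_sqrt_natCast hn))
  rw [h2]
  calc _ ≤ |avg D (fun o => xi P o * noise b g o)| + |avg D (fun o => noise b g o * (u ⬝ᵥ o.Z))| :=
        abs_sub _ _
    _ ≤ K / √n + 2 * d * K / c * (K / √n) := add_le_add h.xi_mul_noise (h1.trans h4)
    _ = _ := by ring

/-- The constant in the bound of `IsRegular.avg_resX_mul_resY_sub_score_sq_le`. -/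
def residualConst (A Q : ℝ) : ℝ := 2 * A * (A + 1) * Q + (A + 1) * Q ^ 2

/-- Pointwise, replacing the residuals by `ξ` and `b ξ + ζ` costs at most a multiple of `‖o‖ ^ 2 /
√n`. Squaring then requires only the empirical fourth moment. -/
theorem IsRegular.avg_resX_mul_resY_sub_score_sq_le (ols : OLS) (hc : 0 < c) (hn : n ≠ 0)
    (h : IsRegular c v K P b g D) (hm : IsBoundedModel A P b g) :
    avg D (fun o => (resX ols D o * resY ols D o - score P b g o) ^ 2)
      ≤ residualConst A (2 * d * K / c) ^ 2 * K / n := by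
  have hK := h.nonneg
  have hA0 : 0 ≤ A := (abs_nonneg b).trans hm.abs_coef
  obtain ⟨u, hu, hX⟩ := h.exists_resX_eq ols hc
  obtain ⟨w, hw, hY⟩ := h.exists_resY_eq ols hc hm.abs_coef
  set Q := 2 * d * K / c with hQ
  have hQ0 : 0 ≤ Q := by positivity
  have hs := one_le_sqrt_natCast hn
  have key (o : Obs d) : |resX ols D o * resY ols D o - score P b g o|
      ≤ residualConst A Q / √n * ‖o‖ ^ 2 := by
    have e1 : |u ⬝ᵥ o.Z| ≤ Q / √n * ‖o‖ := (abs_dotProduct_Z_le u o).trans (by gcongr)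
    have e2 : |w ⬝ᵥ o.Z| ≤ (A + 1) * Q / √n * ‖o‖ := (abs_dotProduct_Z_le w o).trans (by gcongr)
    have e3 : |b * xi P o + noise b g o| ≤ A * (A + 1) * ‖o‖ := by
      calc _ ≤ |b| * |xi P o| + |noise b g o| := by
            rw [← abs_mul]
            exact abs_add_le _ _
        _ ≤ A * (A * ‖o‖) + A * ‖o‖ := by
            gcongr
            exacts [hm.abs_coef, hm.abs_xi o, hm.abs_noise o]
        _ = _ := by ring
    have e4 : resX ols D o * resY ols D o - score P b g o
        = -((b * xi P o + noise b g o) * (u ⬝ᵥ o.Z)) + -(xi P o * (w ⬝ᵥ o.Z))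
          + (w ⬝ᵥ o.Z) * (u ⬝ᵥ o.Z) := by
      rw [hX, hY, score]
      ring
    -- The term with both coefficient errors carries two factors `1 / √n`; one is given up so that
    -- all three terms have the same rate.
    have e5 : Q / √n ≤ Q := div_le_self hQ0 hs
    rw [e4]
    calc _ ≤ |b * xi P o + noise b g o| * |u ⬝ᵥ o.Z| + |xi P o| * |w ⬝ᵥ o.Z|
          + |w ⬝ᵥ o.Z| * |u ⬝ᵥ o.Z| := by
          refine (abs_add_le _ _).trans ?_
          rw [abs_mul (w ⬝ᵥ o.Z), ← abs_mul (xi P o), ← abs_mul (b * xi P o + _)]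
          gcongr
          refine (abs_add_le _ _).trans ?_
          rw [abs_neg, abs_neg]
      _ ≤ A * (A + 1) * ‖o‖ * (Q / √n * ‖o‖) + A * ‖o‖ * ((A + 1) * Q / √n * ‖o‖)
          + (A + 1) * Q / √n * ‖o‖ * (Q * ‖o‖) := by
          gcongr
          · exact hm.abs_xi o
          · exact e1.trans (by gcongr)
      _ = _ := by
          rw [residualConst]
          ring
  calc _ ≤ avg D (fun o => residualConst A Q ^ 2 / n * ‖o‖ ^ 4) := by
        refine avg_mono D fun o => ?_
        rw [← sq_abs]
        calc _ ≤ (residualConst A Q / √n * ‖o‖ ^ 2) ^ 2 := by gcongr; exact key o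
          _ = _ := by
            rw [mul_pow, div_pow, Real.sq_sqrt (Nat.cast_nonneg n)]
            ring
    _ ≤ residualConst A Q ^ 2 / n * K := by
        rw [avg_const_mul]
        gcongr
        exact h.norm_pow_four
    _ = _ := by ring

theorem IsBoundedModel.nonneg (hm : IsBoundedModel A P b g) : 0 ≤ A :=
  (abs_nonneg b).trans hm.abs_coef

theorem IsBoundedModel.abs_score_le (hm : IsBoundedModel A P b g) (o : Obs d) :
    |score P b g o| ≤ A ^ 2 * (A + 1) * ‖o‖ ^ 2 := by
  have hA0 := hm.nonneg
  rw [score, abs_mul]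
  calc _ ≤ (|b| * |xi P o| + |noise b g o|) * |xi P o| := by
        gcongr
        rw [← abs_mul]
        exact abs_add_le _ _
    _ ≤ (A * (A * ‖o‖) + A * ‖o‖) * (A * ‖o‖) := by
        gcongr
        exacts [hm.abs_coef, hm.abs_xi o, hm.abs_noise o, hm.abs_xi o]
    _ = _ := by ring

theorem IsRegular.avg_score_sq_le (h : IsRegular c v K P b g D) (hm : IsBoundedModel A P b g) :
    avg D (fun o => score P b g o ^ 2) ≤ (A ^ 2 * (A + 1)) ^ 2 * K := by
  calc _ ≤ avg D (fun o => (A ^ 2 * (A + 1)) ^ 2 * ‖o‖ ^ 4) := by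
        refine avg_mono D fun o => ?_
        rw [← sq_abs]
        calc _ ≤ (A ^ 2 * (A + 1) * ‖o‖ ^ 2) ^ 2 := by gcongr; exact hm.abs_score_le o
          _ = _ := by ring
    _ ≤ _ := by
        rw [avg_const_mul]
        gcongr
        exact h.norm_pow_four

set_option maxHeartbeats 1000000 in
/-- On regular samples, the test rejects at distant alternatives. -/
theorem exists_forall_lt_T (d : ℕ) (ols : OLS) {c v K A : ℝ} (hc : 0 < c) (hv : 0 < v) (z : ℝ) :
    ∃ κ₀ : ℝ, ∃ n₀ : ℕ, ∀ κ ≥ κ₀, ∀ n ≥ n₀, ∀ (P : Measure (Obs d)) (b : ℝ) (g : Fin d → ℝ)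
      (D₁ D₂ : Fin n → Obs d), IsBoundedModel A P b g → IsRegular c v K P b g D₁ →
      IsRegular c v K P b g D₂ → κ / √n ≤ |b| → z < T ols D₁ D₂ := by
  -- `Q / √n` bounds the coefficient error for `X`, `H / n` the mean square error of replacing
  -- residual products by the score, `E / √n` the noise, and `R` the sample variance. Below, `n₁`
  -- ensures that the mean square of `resX` is at least `c / 4`, `n₂` that the sample variance is
  -- positive. The threshold for `κ` uses `|E|` because `K ≥ 0` is known only once a regular sample
  -- is given.
  set Q := 2 * d * K / c with hQ
  set H := residualConst A Q ^ 2 * K with hH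
  set E := K + Q * K with hE
  set R := 2 * ((A ^ 2 * (A + 1)) ^ 2 * K) + 2 * H with hR
  obtain ⟨n₁, hn₁⟩ := exists_nat_gt (4 * (Q * K) / c)
  obtain ⟨n₂, hn₂⟩ := exists_nat_gt (2 * H / v)
  refine ⟨4 * (|z| * √R + |E| + 1) / c, max 1 (max n₁ n₂), fun κ hκ n hn P b g D₁ D₂ hm h₁ h₂ hb =>
    ?_⟩
  have hn1 : 1 ≤ n := (le_max_left _ _).trans hn
  have hn0 : n ≠ 0 := by omega
  have hnpos : (0 : ℝ) < n := by positivity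
  have hnn₁ : (n₁ : ℝ) ≤ n := by
    exact_mod_cast ((le_max_left _ _).trans (le_max_right _ _)).trans hn
  have hnn₂ : (n₂ : ℝ) ≤ n := by
    exact_mod_cast ((le_max_right _ _).trans (le_max_right _ _)).trans hn
  have hK := h₁.nonneg
  have hs : 0 < √(n : ℝ) := Real.sqrt_pos.2 hnpos
  have hκ' : |z| * √R + |E| + 1 ≤ κ * (c / 4) := by
    rw [ge_iff_le, div_le_iff₀ hc] at hκ
    linarith
  have hκ0 : 0 < κ := by
    by_contra! hcon
    have h1 : κ * (c / 4) ≤ 0 := mul_nonpos_of_nonpos_of_nonneg hcon (by positivity)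
    have h2 : 0 ≤ |z| * √R := by positivity
    linarith [abs_nonneg E]
  have hbpos : 0 < |b| := lt_of_lt_of_le (by positivity) hb
  have hsb : κ ≤ √n * |b| := by
    rw [div_le_iff₀ hs] at hb
    linarith
  have hb0 : b ≠ 0 := abs_pos.1 hbpos
  have hQK : Q * K / n ≤ c / 4 := by
    rw [div_lt_iff₀ hc] at hn₁
    rw [div_le_iff₀ hnpos]
    have := mul_le_mul_of_nonneg_right hnn₁ hc.le
    linarith
  -- the signal dominates the noise
  have main (D : Fin n → Obs d) (h : IsRegular c v K P b g D) :
      0 < avg D (fun o => resX ols D o ^ 2) ∧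
      |z| * √R + 1 ≤ √n * (b / |b| * avg D (fun o => o.Y * resX ols D o)) := by
    have hS := h.le_avg_resX_sq ols hc
    have he := h.abs_avg_noise_mul_resX_le ols hc hn0
    rw [avg_Y_mul_resX ols D b g]
    rw [← hQ] at hS he
    rw [← hE] at he
    set S := avg D (fun o => resX ols D o ^ 2)
    set e := avg D (fun o => noise b g o * resX ols D o)
    have hS' : c / 4 ≤ S := by linarith
    refine ⟨by linarith, ?_⟩
    have hσ : |(b / |b|)| = 1 := by rw [abs_div, abs_abs, div_self hbpos.ne']
    have h1 : b / |b| * (b * S + e) = |b| * S + b / |b| * e := by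
      have : b / |b| * b = |b| := by
        rw [div_mul_eq_mul_div, ← abs_mul_abs_self, mul_self_div_self]
      rw [mul_add, ← mul_assoc, this]
    have h2 : -(E / √n) ≤ b / |b| * e := by
      refine (neg_le_neg ?_).trans (neg_abs_le _)
      rwa [abs_mul, hσ, one_mul]
    have h3 : √n * (b / |b| * e) ≥ -E := by
      calc √n * (b / |b| * e) ≥ √n * (-(E / √n)) := by gcongr
        _ = -E := by field_simp
    have h4 : κ * (c / 4) ≤ √n * |b| * S := by gcongr
    rw [h1, mul_add]
    linarith [le_abs_self E]
  obtain ⟨hS₁, hM₁⟩ := main D₁ h₁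
  obtain ⟨hS₂, hM₂⟩ := main D₂ h₂
  have hzR : 0 ≤ |z| * √R := by positivity
  -- On `D₂`, dominance of the signal means that the estimated coefficient of `X` has the sign of
  -- `b`.
  have hpos : 0 < b / |b| * gCoef ols D₂ 0 := by
    rw [← gCoef_mul_avg, ← mul_assoc] at hM₂
    have h1 : 0 < √n * (b / |b| * gCoef ols D₂ 0 * avg D₂ (fun o => resX ols D₂ o ^ 2)) := by
      linarith
    exact pos_of_mul_pos_left (pos_of_mul_pos_right h1 hs.le) hS₂.le
  have hg0 : gCoef ols D₂ 0 ≠ 0 := fun h0 => by simp [h0] at hpos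
  have hsign : gCoef ols D₂ 0 / |gCoef ols D₂ 0| = b / |b| := by
    rcases hb0.lt_or_gt with hb1 | hb1
    · rw [abs_of_neg hb1, div_neg, div_self hb0] at hpos ⊢
      have : gCoef ols D₂ 0 < 0 := by linarith
      rw [abs_of_neg this, div_neg, div_self hg0]
    · rw [abs_of_pos hb1, div_self hb0] at hpos ⊢
      have : 0 < gCoef ols D₂ 0 := by linarith
      rw [abs_of_pos this, div_self hg0]
  rw [T_eq ols D₁ D₂ hn0 hg0 hS₂, hsign, ← mul_div_assoc]
  -- the sample variance is positive and bounded
  have hdiff := h₁.avg_resX_mul_resY_sub_score_sq_le ols hc hn0 hm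
  rw [← hQ, ← hH] at hdiff
  set f : Obs d → ℝ := fun o => resX ols D₁ o * resY ols D₁ o with hf
  set V := avg D₁ (fun o => f o ^ 2) - avg D₁ f ^ 2 with hV
  -- Strict positivity matters since a quotient by zero is `0`. Comparison with the score gives `v ≤
  -- 2 H / n + 2 V`.
  have hVpos : 0 < V := by
    have h1 := avg_sq_sub_sq_avg_le D₁ (score P b g) hn0 (avg D₁ f)
    have h2 : avg D₁ (fun o => (score P b g o - avg D₁ f) ^ 2)
        ≤ 2 * avg D₁ (fun o => (f o - score P b g o) ^ 2)
          + 2 * avg D₁ (fun o => (f o - avg D₁ f) ^ 2) := by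
      rw [← avg_const_mul, ← avg_const_mul, ← avg_add]
      refine avg_mono D₁ fun o => ?_
      nlinarith [sq_nonneg (f o - score P b g o + (f o - avg D₁ f))]
    rw [← avg_sq_sub_sq_avg D₁ f hn0, ← hV] at h2
    have h3 := h₁.variance_score
    have h4 : 2 * (H / n) < v := by
      rw [div_lt_iff₀ hv] at hn₂
      rw [← mul_div_assoc, div_lt_iff₀ hnpos, mul_comm v]
      exact hn₂.trans_le (mul_le_mul_of_nonneg_right hnn₂ hv.le)
    linarith
  have hVR : V ≤ R := by
    have h1 : avg D₁ (fun o => f o ^ 2) ≤ 2 * avg D₁ (fun o => score P b g o ^ 2)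
        + 2 * avg D₁ (fun o => (f o - score P b g o) ^ 2) := by
      rw [← avg_const_mul, ← avg_const_mul, ← avg_add]
      refine avg_mono D₁ fun o => ?_
      nlinarith [sq_nonneg (f o - 2 * score P b g o)]
    have h2 := h₁.avg_score_sq_le hm
    have h3 : H / n ≤ H := div_le_self (by positivity) (by exact_mod_cast hn1)
    have := sq_nonneg (avg D₁ f)
    linarith
  rw [lt_div_iff₀ (Real.sqrt_pos.2 hVpos)]
  calc z * √V ≤ |z| * √R := by gcongr; exact le_abs_self z
    _ < |z| * √R + 1 := by linarith
    _ ≤ √n * (b / |b| * avg D₁ (fun o => o.Y * resX ols D₁ o)) := hM₁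
    _ = b / |b| * (√n * avg D₁ f) := by
      rw [hf, avg_resX_mul_resY]
      ring

end Regular

/-! ### Population moments -/

/-- The quadratic form of a symmetric matrix is bounded below by its least eigenvalue. -/
theorem MinEigenvalueGE.le_dotProduct_mulVec {k : ℕ} {A : Matrix (Fin k) (Fin k) ℝ} {c : ℝ}
    (h : MinEigenvalueGE A c) (hA : A.IsHermitian) (u : Fin k → ℝ) :
    c * ∑ j, u j ^ 2 ≤ u ⬝ᵥ A.mulVec u := by
  have hB : (A - c • (1 : Matrix (Fin k) (Fin k) ℝ)).IsHermitian :=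
    hA.sub (Matrix.isHermitian_one.smul (by simp [IsSelfAdjoint]))
  have hpos : (A - c • (1 : Matrix (Fin k) (Fin k) ℝ)).PosSemidef := by
    rw [hB.posSemidef_iff_eigenvalues_nonneg]
    intro i
    have h1 := hB.mulVec_eigenvectorBasis i
    rw [Matrix.sub_mulVec, Matrix.smul_mulVec, Matrix.one_mulVec, sub_eq_iff_eq_add,
      ← add_smul] at h1
    have h2 := h (hB.eigenvalues i + c) (Module.End.hasEigenvalue_of_hasEigenvector
      (x := ⇑(hB.eigenvectorBasis i)) ⟨Module.End.mem_eigenspace_iff.2 h1, fun h0 => ?_⟩)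
    · simpa using h2
    · refine hB.eigenvectorBasis.orthonormal.ne_zero i ?_
      ext j
      exact congrFun h0 j
  have h3 := hpos.re_dotProduct_nonneg u
  simp only [star_trivial, Matrix.sub_mulVec, Matrix.smul_mulVec, Matrix.one_mulVec,
    dotProduct_sub, dotProduct_smul, smul_eq_mul, RCLike.re_to_real] at h3
  have h4 : u ⬝ᵥ u = ∑ j, u j ^ 2 := by simp [dotProduct, sq]
  rw [h4] at h3
  linarith

section Moments

variable {d : ℕ} {P : Measure (Obs d)}

@[fun_prop] theorem measurable_X : Measurable (fun o : Obs d => o.X) := measurable_fst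

@[fun_prop] theorem measurable_Y : Measurable (fun o : Obs d => o.Y) :=
  measurable_fst.comp measurable_snd

@[fun_prop] theorem measurable_Z : Measurable (fun o : Obs d => o.Z) :=
  measurable_snd.comp measurable_snd

@[fun_prop] theorem measurable_Z_apply (j : Fin d) : Measurable (fun o : Obs d => o.Z j) :=
  (measurable_pi_apply j).comp measurable_Z

@[fun_prop] theorem measurable_dotProduct_Z (u : Fin d → ℝ) :
    Measurable (fun o : Obs d => u ⬝ᵥ o.Z) := by
  simp only [dotProduct]
  fun_prop

@[fun_prop] theorem measurable_dotProduct_W (u : Fin (d + 1) → ℝ) :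
    Measurable (fun o : Obs d => u ⬝ᵥ o.W) := by
  simp only [dotProduct_W]
  fun_prop

@[fun_prop] theorem measurable_xi (P : Measure (Obs d)) : Measurable (fun o => xi P o) := by
  unfold xi
  fun_prop

@[fun_prop] theorem measurable_noise (b : ℝ) (g : Fin d → ℝ) :
    Measurable (fun o : Obs d => noise b g o) := by
  unfold noise
  fun_prop

@[fun_prop] theorem measurable_score (P : Measure (Obs d)) (b : ℝ) (g : Fin d → ℝ) :
    Measurable (fun o => score P b g o) := by
  unfold score
  fun_prop

/-- The moments of order `4` and `4 + δ` of the norm of the observation are at most `M`. -/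
structure HasMoments (δ M : ℝ) (P : Measure (Obs d)) : Prop where
  integrable_rpow : Integrable (fun o => ‖o‖ ^ (4 + δ)) P
  integral_rpow_le : ∫ o, ‖o‖ ^ (4 + δ) ∂P ≤ M
  integrable_pow_four : Integrable (fun o => ‖o‖ ^ 4) P
  integral_pow_four_le : ∫ o, ‖o‖ ^ 4 ∂P ≤ M

/-- The norm is the maximum of the norms of `X`, `Y` and `Z`, so its power is at most the sum of
their powers; the fourth moment costs an additional `1`. -/
theorem MomentBound.hasMoments [IsProbabilityMeasure P] {C δ : ℝ} (hC : 0 < C) (hδ : 0 < δ)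
    (h : MomentBound C δ P) : HasMoments δ (1 + 3 * C) P := by
  have hp : 0 ≤ 4 + δ := by linarith
  have hle (o : Obs d) : ‖o‖ₑ ^ (4 + δ)
      ≤ ‖o.Z‖ₑ ^ (4 + δ) + ‖o.Y‖ₑ ^ (4 + δ) + ‖o.X‖ₑ ^ (4 + δ) := by
    have h1 : ‖o‖ₑ = ‖o.X‖ₑ ⊔ (‖o.Y‖ₑ ⊔ ‖o.Z‖ₑ) := by
      simp only [enorm_eq_nnnorm, ← ENNReal.coe_max, Prod.nnnorm_def]
      rfl
    rw [h1, (ENNReal.monotone_rpow_of_nonneg hp).map_sup,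
      (ENNReal.monotone_rpow_of_nonneg hp).map_sup]
    refine sup_le le_add_self (sup_le ?_ ?_)
    · exact le_add_self.trans le_self_add
    · exact le_self_add.trans le_self_add
  have hint : ∫⁻ o, ‖o‖ₑ ^ (4 + δ) ∂P ≤ ENNReal.ofReal (3 * C) := by
    calc _ ≤ ∫⁻ o : Obs d, (‖o.Z‖ₑ ^ (4 + δ) + ‖o.Y‖ₑ ^ (4 + δ) + ‖o.X‖ₑ ^ (4 + δ)) ∂P :=
          lintegral_mono hle
      _ = ∫⁻ o : Obs d, ‖o.Z‖ₑ ^ (4 + δ) ∂P + ∫⁻ o : Obs d, ‖o.Y‖ₑ ^ (4 + δ) ∂P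
          + ∫⁻ o : Obs d, ‖o.X‖ₑ ^ (4 + δ) ∂P := by
          rw [lintegral_add_left (by fun_prop), lintegral_add_left (by fun_prop)]
      _ ≤ ENNReal.ofReal C + ENNReal.ofReal C + ENNReal.ofReal C :=
          add_le_add (add_le_add h.1 h.2.1) h.2.2
      _ = _ := by
          rw [← ENNReal.ofReal_add hC.le hC.le, ← ENNReal.ofReal_add (by positivity) hC.le]
          congr 1
          ring
  have henorm (o : Obs d) : ENNReal.ofReal (‖o‖ ^ (4 + δ)) = ‖o‖ₑ ^ (4 + δ) := by
    rw [← ofReal_norm, ENNReal.ofReal_rpow_of_nonneg (norm_nonneg o) hp]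
  have hmeas : AEStronglyMeasurable (fun o : Obs d => ‖o‖ ^ (4 + δ)) P :=
    (measurable_norm.pow_const _).aestronglyMeasurable
  have hnn (o : Obs d) : 0 ≤ ‖o‖ ^ (4 + δ) := Real.rpow_nonneg (norm_nonneg o) _
  have hI : Integrable (fun o : Obs d => ‖o‖ ^ (4 + δ)) P := by
    refine ⟨hmeas, ?_⟩
    rw [hasFiniteIntegral_iff_ofReal (ae_of_all _ hnn)]
    simp only [henorm]
    exact hint.trans_lt ENNReal.ofReal_lt_top
  have hI2 : ∫ o, ‖o‖ ^ (4 + δ) ∂P ≤ 3 * C := by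
    rw [integral_eq_lintegral_of_nonneg_ae (ae_of_all _ hnn) hmeas]
    simp only [henorm]
    exact ENNReal.toReal_le_of_le_ofReal (by positivity) hint
  have hpow (o : Obs d) : ‖o‖ ^ 4 ≤ 1 + ‖o‖ ^ (4 + δ) := by
    rcases le_total ‖o‖ 1 with h1 | h1
    · have := pow_le_one₀ (n := 4) (norm_nonneg o) h1
      linarith [hnn o]
    · have : ‖o‖ ^ (4 : ℝ) ≤ ‖o‖ ^ (4 + δ) := Real.rpow_le_rpow_of_exponent_le h1 (by linarith)
      have h2 : ‖o‖ ^ (4 : ℝ) = ‖o‖ ^ 4 := by exact_mod_cast Real.rpow_natCast ‖o‖ 4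
      rw [← h2]
      linarith
  have hI3 : Integrable (fun o : Obs d => 1 + ‖o‖ ^ (4 + δ)) P := (integrable_const 1).add hI
  have hI4 : Integrable (fun o : Obs d => ‖o‖ ^ 4) P :=
    hI3.mono' (measurable_norm.pow_const _).aestronglyMeasurable (ae_of_all _ fun o => by
      rw [Real.norm_of_nonneg (by positivity)]
      exact hpow o)
  refine ⟨hI, by linarith, hI4, ?_⟩
  calc _ ≤ ∫ o, (1 + ‖o‖ ^ (4 + δ)) ∂P := integral_mono hI4 hI3 hpow
    _ ≤ _ := by
      rw [integral_add (integrable_const 1) hI]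
      simp only [integral_const, probReal_univ, one_smul]
      linarith

variable [IsProbabilityMeasure P] {δ M : ℝ}

theorem pow_le_one_add_pow_four {x : ℝ} (hx : 0 ≤ x) {k : ℕ} (hk : k ≤ 4) : x ^ k ≤ 1 + x ^ 4 := by
  rcases le_total x 1 with h1 | h1
  · have := pow_le_one₀ (n := k) hx h1
    linarith [pow_nonneg hx 4]
  · have := pow_le_pow_right₀ h1 hk
    linarith

theorem HasMoments.integrable (h : HasMoments δ M P) {f : Obs d → ℝ} (hf : Measurable f)
    {A : ℝ} {k : ℕ} (hk : k ≤ 4) (hA : ∀ o, |f o| ≤ A * ‖o‖ ^ k) : Integrable f P := by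
  have h1 : Integrable (fun o : Obs d => |A| * (1 + ‖o‖ ^ 4)) P :=
    ((integrable_const 1).add h.integrable_pow_four).const_mul _
  refine h1.mono' hf.aestronglyMeasurable (ae_of_all _ fun o => ?_)
  calc _ ≤ A * ‖o‖ ^ k := hA o
    _ ≤ |A| * ‖o‖ ^ k := by gcongr; exact le_abs_self A
    _ ≤ _ := by
      gcongr
      exact pow_le_one_add_pow_four (norm_nonneg o) hk

theorem HasMoments.integral_sq_le (h : HasMoments δ M P) {f : Obs d → ℝ} (hf : Measurable f)
    {A : ℝ} (hA : ∀ o, |f o| ≤ A * ‖o‖ ^ 2) :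
    Integrable (fun o => f o ^ 2) P ∧ ∫ o, f o ^ 2 ∂P ≤ A ^ 2 * M := by
  have hle (o : Obs d) : f o ^ 2 ≤ A ^ 2 * ‖o‖ ^ 4 := by
    rw [← sq_abs]
    calc |f o| ^ 2 ≤ (A * ‖o‖ ^ 2) ^ 2 := by gcongr; exact hA o
      _ = _ := by ring
  have hI : Integrable (fun o => f o ^ 2) P := h.integrable (hf.pow_const 2) le_rfl fun o => by
    rw [abs_of_nonneg (sq_nonneg _)]
    exact hle o
  refine ⟨hI, (integral_mono hI (h.integrable_pow_four.const_mul _) hle).trans ?_⟩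
  rw [integral_const_mul]
  gcongr
  exact h.integral_pow_four_le

theorem abs_mul_le_of_le {x y a b r : ℝ} {k l : ℕ} (hx : |x| ≤ a * r ^ k) (hy : |y| ≤ b * r ^ l) :
    |x * y| ≤ a * b * r ^ (k + l) := by
  rw [abs_mul]
  calc |x| * |y| ≤ (a * r ^ k) * (b * r ^ l) :=
        mul_le_mul hx hy (abs_nonneg _) ((abs_nonneg _).trans hx)
    _ = _ := by ring

theorem abs_X_le' (o : Obs d) : |o.X| ≤ 1 * ‖o‖ ^ 1 := by simpa using abs_X_le o

theorem abs_Y_le' (o : Obs d) : |o.Y| ≤ 1 * ‖o‖ ^ 1 := by simpa using abs_Y_le o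

theorem abs_Z_le' (o : Obs d) (j : Fin d) : |o.Z j| ≤ 1 * ‖o‖ ^ 1 := by simpa using abs_Z_le o j

theorem abs_W_le (o : Obs d) (j : Fin (d + 1)) : |o.W j| ≤ ‖o‖ := by
  refine Fin.cases ?_ (fun j => ?_) j
  · simpa [Obs.W] using abs_X_le o
  · simpa [Obs.W] using abs_Z_le o j

theorem abs_dotProduct_W_le (u : Fin (d + 1) → ℝ) (o : Obs d) :
    |u ⬝ᵥ o.W| ≤ (∑ j, |u j|) * ‖o‖ ^ 1 := by
  rw [dotProduct, Finset.sum_mul, pow_one]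
  refine (Finset.abs_sum_le_sum_abs _ _).trans (Finset.sum_le_sum fun j _ => ?_)
  rw [abs_mul]
  exact mul_le_mul_of_nonneg_left (abs_W_le o j) (abs_nonneg _)

theorem abs_xi_le_sum (P : Measure (Obs d)) (o : Obs d) :
    |xi P o| ≤ (1 + ∑ j, |eta P j|) * ‖o‖ ^ 1 := by
  rw [xi, pow_one, add_mul, one_mul]
  exact (abs_sub _ _).trans (add_le_add (abs_X_le o) (abs_dotProduct_Z_le _ o))

theorem abs_noise_le_sum (b : ℝ) (g : Fin d → ℝ) (o : Obs d) :
    |noise b g o| ≤ (1 + |b| + ∑ j, |g j|) * ‖o‖ ^ 1 := by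
  rw [noise, pow_one, add_mul, add_mul, one_mul]
  refine (abs_sub _ _).trans (add_le_add ((abs_sub _ _).trans (add_le_add (abs_Y_le o) ?_))
    (abs_dotProduct_Z_le _ o))
  rw [abs_mul]
  exact mul_le_mul_of_nonneg_left (abs_X_le o) (abs_nonneg _)

theorem HasMoments.sigmaXZ_form (h : HasMoments δ M P) (u : Fin (d + 1) → ℝ) :
    u ⬝ᵥ (sigmaXZ P).mulVec u = ∫ o, (u ⬝ᵥ o.W) ^ 2 ∂P := by
  have hm (j : Fin (d + 1)) : Measurable fun o : Obs d => o.W j := by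
    refine Fin.cases ?_ (fun j => ?_) j
    · simpa [Obs.W] using measurable_X
    · simpa [Obs.W] using measurable_Z_apply j
  have hI (i j : Fin (d + 1)) : Integrable (fun o : Obs d => u i * (u j * (o.W i * o.W j))) P :=
    ((h.integrable ((hm i).mul (hm j)) (k := 2) (by norm_num) (A := 1) fun o => by
      rw [Pi.mul_apply, abs_mul, one_mul, sq]
      exact mul_le_mul (abs_W_le o i) (abs_W_le o j) (abs_nonneg _)
        (norm_nonneg _)).const_mul _).const_mul _
  have h1 (o : Obs d) : (u ⬝ᵥ o.W) ^ 2 = ∑ i, ∑ j, u i * (u j * (o.W i * o.W j)) := by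
    rw [sq, dotProduct, Finset.sum_mul_sum]
    exact Finset.sum_congr rfl fun i _ => Finset.sum_congr rfl fun j _ => by ring
  simp only [h1]
  rw [integral_finsetSum _ fun i _ => integrable_finsetSum _ fun j _ => hI i j]
  simp only [dotProduct, Matrix.mulVec, Finset.mul_sum]
  refine Finset.sum_congr rfl fun i _ => ?_
  rw [integral_finsetSum _ fun j _ => hI i j]
  refine Finset.sum_congr rfl fun j _ => ?_
  rw [integral_const_mul, integral_const_mul, sigmaXZ, Matrix.of_apply]
  ring

variable {c b : ℝ} {g : Fin d → ℝ}

theorem HasMoments.le_integral_dotProduct_W_sq (h : HasMoments δ M P)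
    (hP : NondegeneracyBound c P b g) (u : Fin (d + 1) → ℝ) :
    c * ∑ j, u j ^ 2 ≤ ∫ o, (u ⬝ᵥ o.W) ^ 2 ∂P := by
  rw [← h.sigmaXZ_form]
  refine hP.eig_sigmaXZ.le_dotProduct_mulVec ?_ u
  ext i j
  simp only [Matrix.conjTranspose_apply, sigmaXZ, Matrix.of_apply, star_trivial]
  simp only [mul_comm]

/-- Vectors with zero `X`-coordinate: the Gram matrix of `Z` is a principal submatrix of that of
`W`. -/
theorem HasMoments.le_integral_dotProduct_Z_sq (h : HasMoments δ M P)
    (hP : NondegeneracyBound c P b g) (u : Fin d → ℝ) :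
    c * ∑ j, u j ^ 2 ≤ ∫ o, (u ⬝ᵥ o.Z) ^ 2 ∂P := by
  have h1 := h.le_integral_dotProduct_W_sq hP (Fin.cons 0 u)
  simpa [Fin.sum_univ_succ, dotProduct_W] using h1

/-- The coefficients of an orthogonal projection onto `W` are bounded. -/
theorem HasMoments.sum_abs_le_of_projection (h : HasMoments δ M P) (hc : 0 < c)
    (hP : NondegeneracyBound c P b g) (u : Fin (d + 1) → ℝ) {V : Obs d → ℝ} (hV : Measurable V)
    (hV1 : ∀ o, |V o| ≤ 1 * ‖o‖ ^ 1)
    (horth : ∫ o, (u ⬝ᵥ o.W) * (V o - u ⬝ᵥ o.W) ∂P = 0) :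
    ∑ j, |u j| ≤ d + 1 + (1 + M) / c := by
  have hW2 : Integrable (fun o : Obs d => (u ⬝ᵥ o.W) ^ 2) P := by
    simp only [sq]
    exact h.integrable (by fun_prop) (k := 1 + 1) (by norm_num)
      fun o => abs_mul_le_of_le (abs_dotProduct_W_le u o) (abs_dotProduct_W_le u o)
  have hV2 : Integrable (fun o : Obs d => V o ^ 2) P := by
    simp only [sq]
    exact h.integrable (by fun_prop) (k := 1 + 1) (by norm_num)
      fun o => abs_mul_le_of_le (hV1 o) (hV1 o)
  have hVW : Integrable (fun o : Obs d => (u ⬝ᵥ o.W) * V o) P :=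
    h.integrable (by fun_prop) (k := 1 + 1) (by norm_num)
      fun o => abs_mul_le_of_le (abs_dotProduct_W_le u o) (hV1 o)
  -- Orthogonality, together with `2xy ≤ x² + y²`, shows that projecting does not increase the
  -- second moment; the eigenvalue bound turns this into a bound on `u`.
  have h1 : ∫ o, (u ⬝ᵥ o.W) ^ 2 ∂P = ∫ o, (u ⬝ᵥ o.W) * V o ∂P := by
    rw [eq_comm, ← sub_eq_zero, ← integral_sub hVW hW2, ← horth]
    exact integral_congr_ae (ae_of_all _ fun o => by ring)
  have h2 : 2 * ∫ o, (u ⬝ᵥ o.W) * V o ∂P ≤ ∫ o, (u ⬝ᵥ o.W) ^ 2 ∂P + ∫ o, V o ^ 2 ∂P := by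
    rw [← integral_const_mul, ← integral_add hW2 hV2]
    refine integral_mono (hVW.const_mul 2) (hW2.add hV2) fun o => ?_
    have := two_mul_le_add_sq (u ⬝ᵥ o.W) (V o)
    simp only
    linarith
  have h3 : ∫ o, V o ^ 2 ∂P ≤ 1 + M := by
    calc _ ≤ ∫ o : Obs d, (1 + ‖o‖ ^ 4) ∂P := by
          refine integral_mono hV2 ((integrable_const 1).add h.integrable_pow_four) fun o => ?_
          refine le_trans ?_ (pow_le_one_add_pow_four (norm_nonneg o) (k := 2) (by norm_num))
          rw [← sq_abs]
          have := hV1 o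
          rw [one_mul, pow_one] at this
          gcongr
      _ ≤ _ := by
          rw [integral_add (integrable_const 1) h.integrable_pow_four]
          simp only [integral_const, probReal_univ, one_smul]
          linarith [h.integral_pow_four_le]
  have h4 := h.le_integral_dotProduct_W_sq hP u
  have h5 : ∑ j, u j ^ 2 ≤ (1 + M) / c := by
    rw [le_div_iff₀ hc]
    linarith
  calc ∑ j, |u j| ≤ ∑ j, (1 + u j ^ 2) := Finset.sum_le_sum fun j _ => by
        nlinarith [sq_abs (u j), sq_nonneg (|u j| - 1), abs_nonneg (u j)]
    _ = d + 1 + ∑ j, u j ^ 2 := by simp [Finset.sum_add_distrib]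
    _ ≤ _ := by linarith

/-- These are the population normal equations, available because `E(ZZᵀ)` is invertible. -/
theorem HasMoments.integral_Z_mul_xi (h : HasMoments δ M P) (hP : NondegeneracyBound c P b g)
    (j : Fin d) : ∫ o, o.Z j * xi P o ∂P = 0 := by
  have h1 : (sigmaZ P).mulVec (eta P) = fun i => ∫ o, o.X * o.Z i ∂P := by
    rw [eta, Matrix.mulVec_mulVec, Matrix.mul_nonsing_inv _
      ((Matrix.isUnit_iff_isUnit_det _).1 hP.isUnit_sigmaZ), Matrix.one_mulVec]
  have h2 := congrFun h1 j
  have hI (k : Fin d) : Integrable (fun o : Obs d => eta P k * (o.Z j * o.Z k)) P :=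
    (h.integrable (by fun_prop) (k := 1 + 1) (by norm_num)
      fun o => abs_mul_le_of_le (abs_Z_le' o j) (abs_Z_le' o k)).const_mul _
  have hX : Integrable (fun o : Obs d => o.X * o.Z j) P :=
    h.integrable (by fun_prop) (k := 1 + 1) (by norm_num)
      fun o => abs_mul_le_of_le (abs_X_le' o) (abs_Z_le' o j)
  have h3 (o : Obs d) : o.Z j * xi P o = o.X * o.Z j - ∑ k, eta P k * (o.Z j * o.Z k) := by
    rw [xi, dotProduct, mul_sub, Finset.mul_sum, mul_comm]
    congr 1
    exact Finset.sum_congr rfl fun k _ => by ring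
  simp only [h3]
  rw [integral_sub hX (integrable_finsetSum _ fun k _ => hI k),
    integral_finsetSum _ fun k _ => hI k, ← h2, sub_eq_zero, Matrix.mulVec, dotProduct]
  refine Finset.sum_congr rfl fun k _ => ?_
  rw [integral_const_mul, sigmaZ, Matrix.of_apply, mul_comm]

theorem sigmaXZ_le : Obs.sigmaXZ d ≤ (inferInstance : MeasurableSpace (Obs d)) :=
  Measurable.comap_le (measurable_X.prodMk measurable_Z)

theorem measurable_sigmaXZ {F : ℝ × (Fin d → ℝ) → ℝ} (hF : Measurable F) :
    StronglyMeasurable[Obs.sigmaXZ d] (fun o : Obs d => F (o.X, o.Z)) :=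
  (hF.comp (comap_measurable (fun o : Obs d => (o.X, o.Z)))).stronglyMeasurable

/-- The noise is orthogonal to functions of `(X, Z)`. -/
theorem IsLinearModel.integral_mul_noise (hm : IsLinearModel P b g) {f : Obs d → ℝ}
    (hf : StronglyMeasurable[Obs.sigmaXZ d] f) (hI : Integrable (fun o => f o * noise b g o) P) :
    ∫ o, f o * noise b g o ∂P = 0 := by
  have h1 := condExp_mul_of_stronglyMeasurable_left hf hI hm.1
  rw [← integral_condExp sigmaXZ_le]
  refine integral_eq_zero_of_ae ?_
  refine EventuallyEq.trans h1 ?_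
  filter_upwards [hm.2] with o ho
  simp [ho]

theorem measurable_sigmaXZ_xi (P : Measure (Obs d)) :
    StronglyMeasurable[Obs.sigmaXZ d] (fun o => xi P o) :=
  measurable_sigmaXZ (F := fun w => w.1 - eta P ⬝ᵥ w.2) (by
    simp only [dotProduct]
    fun_prop)

/-- The bound on the coefficients and the residuals of the models of the family. -/
def modelConst (d : ℕ) (c M : ℝ) : ℝ := 1 + (d + 1 + (1 + M) / c)

/-- Both `(0, η)` and `(b, g)` are coefficient vectors of linear combinations of `W` orthogonal to
their residuals `ξ` and `ζ`, with responses `X` and `Y`. Hence the moment and eigenvalue bounds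
control them uniformly; in particular `β` is bounded over the family. -/
theorem HasMoments.isBoundedModel (h : HasMoments δ M P) (hc : 0 < c)
    (hP : NondegeneracyBound c P b g) (hm : IsLinearModel P b g) :
    IsBoundedModel (modelConst d c M) P b g := by
  have h1 : ∑ j, |eta P j| ≤ d + 1 + (1 + M) / c := by
    have hxi (o : Obs d) : o.X - (Fin.cons 0 (eta P) : Fin (d + 1) → ℝ) ⬝ᵥ o.W = xi P o := by
      simp [dotProduct_W, xi]
    have h2 := h.sum_abs_le_of_projection hc hP (Fin.cons 0 (eta P)) measurable_X abs_X_le' (by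
      simp only [hxi]
      simp only [dotProduct_W, Fin.cons_zero, Fin.tail_cons, zero_mul, zero_add]
      simp only [dotProduct, Finset.sum_mul, mul_assoc]
      rw [integral_finsetSum _ fun j _ => ?_]
      · refine Finset.sum_eq_zero fun j _ => ?_
        rw [integral_const_mul, h.integral_Z_mul_xi hP, mul_zero]
      · exact (h.integrable (by fun_prop) (k := 1 + 1) (by norm_num)
          fun o => abs_mul_le_of_le (abs_Z_le' o j) (abs_xi_le_sum P o)).const_mul _)
    simpa [Fin.sum_univ_succ] using h2
  have h2 : |b| + ∑ j, |g j| ≤ d + 1 + (1 + M) / c := by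
    have hz (o : Obs d) : o.Y - (Fin.cons b g : Fin (d + 1) → ℝ) ⬝ᵥ o.W = noise b g o := by
      simp only [dotProduct_W, noise, Fin.cons_zero, Fin.tail_cons]
      ring
    have h3 := h.sum_abs_le_of_projection hc hP (Fin.cons b g) measurable_Y abs_Y_le' (by
      simp only [hz]
      refine hm.integral_mul_noise ?_ ?_
      · simp only [dotProduct_W]
        refine measurable_sigmaXZ (F := fun w => (Fin.cons b g : Fin (d + 1) → ℝ) 0 * w.1
          + Fin.tail (Fin.cons b g : Fin (d + 1) → ℝ) ⬝ᵥ w.2) ?_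
        simp only [dotProduct]
        fun_prop
      · exact h.integrable (by fun_prop) (k := 1 + 1) (by norm_num)
          fun o => abs_mul_le_of_le (abs_dotProduct_W_le _ o) (abs_noise_le_sum b g o))
    simpa [Fin.sum_univ_succ] using h3
  have h3 : 0 ≤ ∑ j, |g j| := Finset.sum_nonneg fun j _ => abs_nonneg _
  refine ⟨?_, fun o => ?_, fun o => ?_⟩
  · rw [modelConst]
    linarith
  · refine (abs_xi_le_sum P o).trans ?_
    rw [pow_one, modelConst]
    gcongr
  · refine (abs_noise_le_sum b g o).trans ?_
    rw [pow_one, modelConst, add_assoc]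
    gcongr

theorem NondegeneracyBound.le_integral_xi_sq (hP : NondegeneracyBound c P b g) :
    c ≤ ∫ o, xi P o ^ 2 ∂P :=
  hP.var_xi.trans (variance_le_expectation_sq (measurable_xi P).aestronglyMeasurable)

/-- Condition on `(X, Z)`: the factor `ξ ^ 2` comes out, and the conditional second moment of `ζ` is
its conditional variance because its conditional mean vanishes. -/
theorem HasMoments.le_integral_xi_sq_mul_noise_sq (h : HasMoments δ M P)
    (hP : NondegeneracyBound c P b g) (hm : IsLinearModel P b g) :
    c * ∫ o, xi P o ^ 2 ∂P ≤ ∫ o, xi P o ^ 2 * noise b g o ^ 2 ∂P := by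
  have hxi := abs_xi_le_sum P
  have hz := abs_noise_le_sum b g
  have hI1 : Integrable (fun o => xi P o ^ 2) P := by
    simp only [sq]
    exact h.integrable (by fun_prop) (k := 1 + 1) (by norm_num)
      fun o => abs_mul_le_of_le (hxi o) (hxi o)
  have hI2 : Integrable (fun o => noise b g o ^ 2) P := by
    simp only [sq]
    exact h.integrable (by fun_prop) (k := 1 + 1) (by norm_num)
      fun o => abs_mul_le_of_le (hz o) (hz o)
  have hI3 : Integrable (fun o => xi P o ^ 2 * noise b g o ^ 2) P := by
    simp only [sq]
    exact h.integrable (by fun_prop) (k := 1 + 1 + (1 + 1)) (by norm_num) fun o =>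
      abs_mul_le_of_le (abs_mul_le_of_le (hxi o) (hxi o)) (abs_mul_le_of_le (hz o) (hz o))
  have hcv : Var[noise b g; P | Obs.sigmaXZ d] =ᵐ[P]
      P[fun o => noise b g o ^ 2 | Obs.sigmaXZ d] := by
    refine condExp_congr_ae ?_
    filter_upwards [hm.2] with o ho
    simp [ho]
  have hpull := condExp_mul_of_stronglyMeasurable_left
    ((measurable_sigmaXZ_xi P).pow 2) hI3 hI2
  rw [← integral_const_mul, ← integral_condExp sigmaXZ_le (f := fun o => xi P o ^ 2 * _)]
  refine integral_mono_ae (hI1.const_mul c) integrable_condExp ?_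
  filter_upwards [hP.condVar_noise, hcv, hpull] with o h1 h2 h3
  refine le_of_le_of_eq ?_ h3.symm
  rw [h2] at h1
  simp only [Pi.mul_apply, Pi.pow_apply]
  rw [mul_comm]
  exact mul_le_mul_of_nonneg_left h1 (sq_nonneg _)

/-- The score has variance at least `c²`. -/
theorem HasMoments.le_variance_score (h : HasMoments δ M P) (hc : 0 < c)
    (hP : NondegeneracyBound c P b g) (hm : IsLinearModel P b g) (m : ℝ) :
    c ^ 2 ≤ ∫ o, (score P b g o - m) ^ 2 ∂P := by
  have hxi := abs_xi_le_sum P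
  have hz := abs_noise_le_sum b g
  have h2 : Integrable (fun o => xi P o * xi P o) P :=
    h.integrable (by fun_prop) (k := 1 + 1) (by norm_num) fun o => abs_mul_le_of_le (hxi o) (hxi o)
  have h11 : Integrable (fun o => xi P o * noise b g o) P :=
    h.integrable (by fun_prop) (k := 1 + 1) (by norm_num) fun o => abs_mul_le_of_le (hxi o) (hz o)
  have h4 : Integrable (fun o => xi P o * xi P o * (xi P o * xi P o)) P :=
    h.integrable (by fun_prop) (k := 1 + 1 + (1 + 1)) (by norm_num) fun o =>
      abs_mul_le_of_le (abs_mul_le_of_le (hxi o) (hxi o)) (abs_mul_le_of_le (hxi o) (hxi o))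
  have h31 : Integrable (fun o => xi P o * xi P o * (xi P o * noise b g o)) P :=
    h.integrable (by fun_prop) (k := 1 + 1 + (1 + 1)) (by norm_num) fun o =>
      abs_mul_le_of_le (abs_mul_le_of_le (hxi o) (hxi o)) (abs_mul_le_of_le (hxi o) (hz o))
  have h22 : Integrable (fun o => xi P o ^ 2 * noise b g o ^ 2) P := by
    simp only [sq]
    exact h.integrable (by fun_prop) (k := 1 + 1 + (1 + 1)) (by norm_num) fun o =>
      abs_mul_le_of_le (abs_mul_le_of_le (hxi o) (hxi o)) (abs_mul_le_of_le (hz o) (hz o))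
  have hsq : Integrable (fun o => (b * xi P o ^ 2 - m) ^ 2) P :=
    (((h4.const_mul (b ^ 2)).sub (h2.const_mul (2 * b * m))).add (integrable_const (m ^ 2))).congr
      (ae_of_all _ fun o => by
        simp only [Pi.add_apply, Pi.sub_apply]
        ring)
  have hcross : Integrable (fun o => 2 * (b * xi P o ^ 2 - m) * xi P o * noise b g o) P :=
    ((h31.const_mul (2 * b)).sub (h11.const_mul (2 * m))).congr (ae_of_all _ fun o => by
        simp only [Pi.sub_apply]
        ring)
  -- The score is `b ξ² + ξ ζ`. The cross term is linear in `ζ` and integrates to zero, so the `ξ ζ`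
  -- part contributes its full second moment for every `b` and `m`.
  have hzero : ∫ o, 2 * (b * xi P o ^ 2 - m) * xi P o * noise b g o ∂P = 0 :=
    hm.integral_mul_noise (measurable_sigmaXZ (F := fun w =>
      2 * (b * (w.1 - eta P ⬝ᵥ w.2) ^ 2 - m) * (w.1 - eta P ⬝ᵥ w.2)) (by
        simp only [dotProduct]
        fun_prop)) hcross
  have hsplit (o : Obs d) : (score P b g o - m) ^ 2 = (b * xi P o ^ 2 - m) ^ 2
      + 2 * (b * xi P o ^ 2 - m) * xi P o * noise b g o + xi P o ^ 2 * noise b g o ^ 2 := by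
    rw [score]
    ring
  simp only [hsplit]
  have hadd : Integrable (fun o => (b * xi P o ^ 2 - m) ^ 2
      + 2 * (b * xi P o ^ 2 - m) * xi P o * noise b g o) P := hsq.add hcross
  rw [integral_add hadd h22, integral_add hsq hcross, hzero, add_zero]
  have h5 := h.le_integral_xi_sq_mul_noise_sq hP hm
  have h6 := mul_le_mul_of_nonneg_left (hP.le_integral_xi_sq) hc.le
  have h7 : 0 ≤ ∫ o, (b * xi P o ^ 2 - m) ^ 2 ∂P := integral_nonneg fun o => sq_nonneg _
  linarith

end Moments

/-! ### Truncation -/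

section Clip

/-- The truncation of `x` to `[-B, B]`. -/
def clip (B x : ℝ) : ℝ := max (-B) (min x B)

@[fun_prop] theorem measurable_clip (B : ℝ) : Measurable (clip B) := by
  unfold clip
  fun_prop

theorem abs_clip_le {B : ℝ} (hB : 0 ≤ B) (x : ℝ) : |clip B x| ≤ B :=
  abs_le.2 ⟨le_max_left _ _, max_le (by linarith) (min_le_right _ _)⟩

theorem abs_clip_sub_clip_le (B x y : ℝ) : |clip B x - clip B y| ≤ |x - y| := by
  unfold clip
  exact (abs_max_sub_max_le_max _ _ _ _).trans
    (max_le (by simp) ((abs_min_sub_min_le_max _ _ _ _).trans (by simp)))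

theorem abs_clip_le_abs {B : ℝ} (hB : 0 ≤ B) (x : ℝ) : |clip B x| ≤ |x| := by
  have h := abs_clip_sub_clip_le B x 0
  have h0 : clip B 0 = 0 := by
    rw [clip, min_eq_left hB, max_eq_right (by linarith)]
  simpa [h0] using h

theorem abs_sub_clip_le {B : ℝ} (hB : 0 ≤ B) (x : ℝ) : |x - clip B x| ≤ |x| := by
  unfold clip
  rcases le_total x B with h1 | h1
  · rw [min_eq_left h1]
    rcases le_total (-B) x with h2 | h2
    · rw [max_eq_right h2]
      simp
    · rw [max_eq_left h2, abs_of_nonpos (by linarith), abs_of_nonpos (by linarith)]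
      linarith
  · rw [min_eq_right h1, max_eq_right (by linarith), abs_of_nonneg (by linarith),
      abs_of_nonneg (by linarith)]
    linarith

theorem sub_clip_eq_zero {B x : ℝ} (hx : |x| ≤ B) : x - clip B x = 0 := by
  have := abs_le.1 hx
  rw [clip, min_eq_left this.2, max_eq_right this.1, sub_self]

/-- Truncation lowers the sample variance. -/
theorem avg_clip_sq_sub_le {n : ℕ} (hn : n ≠ 0) {α : Type*} (D : Fin n → α) (f : α → ℝ) (B : ℝ) :
    avg D (fun o => clip B (f o) ^ 2) - avg D (fun o => clip B (f o)) ^ 2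
      ≤ avg D (fun o => f o ^ 2) - avg D f ^ 2 := by
  rw [avg_sq_sub_sq_avg D f hn]
  -- The deviations of the truncated values are measured from the truncated mean, where the
  -- contraction property applies termwise.
  refine (avg_sq_sub_sq_avg_le D (fun o => clip B (f o)) hn (clip B (avg D f))).trans
    (avg_mono D fun o => ?_)
  exact sq_le_sq.2 (abs_clip_sub_clip_le _ _ _)

variable {d : ℕ} {P : Measure (Obs d)} [IsProbabilityMeasure P] {δ M c b A : ℝ} {g : Fin d → ℝ}

/-- The truncated score has variance bounded below. -/
theorem HasMoments.le_variance_clip_score (h : HasMoments δ M P) (hδ : 0 < δ) (hc : 0 < c)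
    (hP : NondegeneracyBound c P b g) (hm : IsLinearModel P b g) (hb : IsBoundedModel A P b g)
    {r : ℝ} (hr : 0 < r) (hrδ : (A ^ 2 * (A + 1)) ^ 2 * M ≤ c ^ 2 / 4 * r ^ δ) :
    c ^ 2 / 4 ≤ ∫ o, clip (A ^ 2 * (A + 1) * r ^ 2) (score P b g o) ^ 2 ∂P
      - (∫ o, clip (A ^ 2 * (A + 1) * r ^ 2) (score P b g o) ∂P) ^ 2 := by
  have hA := hb.nonneg
  set A' := A ^ 2 * (A + 1) with hA'
  have hA'0 : 0 ≤ A' := by positivity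
  set B := A' * r ^ 2 with hB
  have hB0 : 0 ≤ B := by positivity
  set φ : Obs d → ℝ := fun o => clip B (score P b g o) with hφ
  have hφm : Measurable φ := (measurable_clip B).comp (measurable_score P b g)
  have hφA (o : Obs d) : |φ o| ≤ A' * ‖o‖ ^ 2 := (abs_clip_le_abs hB0 _).trans (hb.abs_score_le o)
  have hI1 : Integrable φ P := h.integrable hφm (k := 2) (by norm_num) hφA
  have hI2 : Integrable (fun o => φ o ^ 2) P := (h.integral_sq_le hφm hφA).1
  set m := ∫ o, φ o ∂P with hmdef
  have hvar : ∫ o, (φ o - m) ^ 2 ∂P = ∫ o, φ o ^ 2 ∂P - m ^ 2 := by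
    have e (o : Obs d) : (φ o - m) ^ 2 = φ o ^ 2 - 2 * m * φ o + m ^ 2 := by ring
    have hI3 : Integrable (fun o => φ o ^ 2 - 2 * m * φ o) P := hI2.sub (hI1.const_mul _)
    simp only [e]
    rw [integral_add hI3 (integrable_const _), integral_sub hI2 (hI1.const_mul _),
      integral_const_mul, ← hmdef]
    simp only [integral_const, probReal_univ, one_smul]
    ring
  have hIφ : Integrable (fun o => (φ o - m) ^ 2) P := by
    have hI3 : Integrable (fun o => φ o ^ 2 - 2 * m * φ o + m ^ 2) P :=
      (hI2.sub (hI1.const_mul _)).add (integrable_const _)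
    exact hI3.congr (ae_of_all _ fun o => by ring)
  have hdm : Measurable fun o => score P b g o - φ o := (measurable_score P b g).sub hφm
  have hdiff := h.integral_sq_le hdm (A := A') fun o =>
    (abs_sub_clip_le hB0 _).trans (hb.abs_score_le o)
  have hrpos : 0 < r ^ δ := Real.rpow_pos_of_pos hr δ
  -- For `‖o‖ ≤ r` nothing is truncated. Beyond `r`, the squared score is at most `A' ^ 2 ‖o‖ ^ 4`,
  -- and `‖o‖ ^ 4 ≤ ‖o‖ ^ (4 + δ) / r ^ δ`.
  have htail : ∫ o, (score P b g o - φ o) ^ 2 ∂P ≤ c ^ 2 / 4 := by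
    have hpt (o : Obs d) : (score P b g o - φ o) ^ 2 ≤ A' ^ 2 / r ^ δ * ‖o‖ ^ (4 + δ) := by
      have hN : 0 ≤ ‖o‖ ^ (4 + δ) := Real.rpow_nonneg (norm_nonneg o) _
      rcases le_total ‖o‖ r with hor | hor
      · have : |score P b g o| ≤ B := (hb.abs_score_le o).trans (by
          rw [hB]
          gcongr)
        simp only [hφ, sub_clip_eq_zero this, ne_eq, OfNat.ofNat_ne_zero, not_false_eq_true,
          zero_pow]
        positivity
      · have hopos : 0 < ‖o‖ := hr.trans_le hor
        have h1 : (score P b g o - φ o) ^ 2 ≤ (A' * ‖o‖ ^ 2) ^ 2 := by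
          rw [← sq_abs]
          gcongr
          exact (abs_sub_clip_le hB0 _).trans (hb.abs_score_le o)
        have h2 : r ^ δ ≤ ‖o‖ ^ δ := Real.rpow_le_rpow hr.le hor hδ.le
        have h3 : ‖o‖ ^ (4 + δ) = ‖o‖ ^ 4 * ‖o‖ ^ δ := by
          rw [Real.rpow_add hopos]
          congr 1
          exact_mod_cast Real.rpow_natCast ‖o‖ 4
        rw [h3, div_mul_eq_mul_div, le_div_iff₀ hrpos]
        calc _ ≤ (A' * ‖o‖ ^ 2) ^ 2 * ‖o‖ ^ δ := by gcongr
          _ = _ := by ring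
    calc _ ≤ ∫ o, A' ^ 2 / r ^ δ * ‖o‖ ^ (4 + δ) ∂P :=
          integral_mono hdiff.1 (h.integrable_rpow.const_mul _) hpt
      _ ≤ A' ^ 2 / r ^ δ * M := by
          rw [integral_const_mul]
          gcongr
          exact h.integral_rpow_le
      _ ≤ _ := by
          rw [div_mul_eq_mul_div, div_le_iff₀ hrpos]
          exact hrδ
  -- Here `m` is the mean of the truncated score, not of the score. The conclusion is `c² ≤ 2 Var +
  -- 2 (c² / 4)`.
  have hscore := h.le_variance_score hc hP hm m
  have hsplit : ∫ o, (score P b g o - m) ^ 2 ∂P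
      ≤ 2 * ∫ o, (φ o - m) ^ 2 ∂P + 2 * ∫ o, (score P b g o - φ o) ^ 2 ∂P := by
    rw [← integral_const_mul, ← integral_const_mul,
      ← integral_add (hIφ.const_mul 2) (hdiff.1.const_mul 2)]
    refine integral_mono_of_nonneg (ae_of_all _ fun o => sq_nonneg _)
      ((hIφ.const_mul 2).add (hdiff.1.const_mul 2)) (ae_of_all _ fun o => ?_)
    have := sq_nonneg (φ o - m - (score P b g o - φ o))
    simp only
    linarith
  linarith

end Clip

/-! ### Concentration of empirical means -/

section Concentration

variable {d : ℕ} {P : Measure (Obs d)} [IsProbabilityMeasure P] {δ M A : ℝ}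

/-- Chebyshev: quadratic growth of `f` lets the fourth moment bound its variance, and independence
divides it by `n`. -/
theorem HasMoments.measure_le_abs_avg_sub_le (h : HasMoments δ M P) {f : Obs d → ℝ}
    (hf : Measurable f) (hA : ∀ o, |f o| ≤ A * ‖o‖ ^ 2) {n : ℕ} (hn : n ≠ 0) {t : ℝ}
    (ht : 0 < t) :
    (Measure.pi fun _ : Fin n => P) {D | t ≤ |avg D f - ∫ o, f o ∂P|}
      ≤ ENNReal.ofReal (A ^ 2 * M / (n * t ^ 2)) := by
  have hsq := h.integral_sq_le hf hA
  have hL2 : MemLp f 2 P := (memLp_two_iff_integrable_sq hf.aestronglyMeasurable).2 hsq.1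
  have hI : Integrable f P := hL2.integrable one_le_two
  have hn0 : (0 : ℝ) < n := by positivity
  have hsum : (fun D : Fin n → Obs d => avg D f)
      = fun D => (1 / (n : ℝ)) * (∑ i : Fin n, fun D : Fin n → Obs d => f (D i)) D := by
    ext D
    simp [avg]
  have hmem (i : Fin n) : MemLp (fun D : Fin n → Obs d => f (D i)) 2 (Measure.pi fun _ => P) :=
    hL2.comp_measurePreserving (measurePreserving_eval (fun _ => P) i)
  have havg : MemLp (fun D : Fin n → Obs d => avg D f) 2 (Measure.pi fun _ => P) := by
    rw [hsum]
    exact (memLp_finsetSum' _ fun i _ => hmem i).const_mul _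
  have hmean : ∫ D : Fin n → Obs d, avg D f ∂(Measure.pi fun _ => P) = ∫ o, f o ∂P := by
    simp only [avg]
    rw [integral_const_mul, integral_finsetSum _ fun i _ => (hmem i).integrable one_le_two]
    simp only [integral_comp_eval (μ := fun _ : Fin n => P) hf.aestronglyMeasurable]
    simp [hn]
  have hvar : Var[fun D : Fin n → Obs d => avg D f; Measure.pi fun _ => P] ≤ A ^ 2 * M / n := by
    rw [hsum, variance_const_mul, variance_sum_pi fun _ => hL2]
    have h1 : Var[f; P] ≤ A ^ 2 * M :=
      (variance_le_expectation_sq hf.aestronglyMeasurable).trans hsq.2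
    simp only [Finset.sum_const, Finset.card_univ, Fintype.card_fin, nsmul_eq_mul]
    calc _ = Var[f; P] / n := by field_simp
      _ ≤ _ := by gcongr
  have hcheb := meas_ge_le_variance_div_sq havg ht
  rw [hmean] at hcheb
  refine hcheb.trans (ENNReal.ofReal_le_ofReal ?_)
  rw [← div_div]
  gcongr

/-- Markov instead of Chebyshev, since the variance of `‖o‖ ^ 4` would require eighth moments.
Boundedness in probability is enough here. -/
theorem HasMoments.measure_lt_avg_norm_le (h : HasMoments δ M P) {n : ℕ} (hn : n ≠ 0) {K : ℝ}
    (hK : 0 < K) :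
    (Measure.pi fun _ : Fin n => P) {D | K < avg D (fun o => ‖o‖ ^ 4)}
      ≤ ENNReal.ofReal (M / K) := by
  have hint (i : Fin n) : Integrable (fun D : Fin n → Obs d => ‖D i‖ ^ 4)
      (Measure.pi fun _ => P) := integrable_comp_eval (μ := fun _ : Fin n => P) (f := fun o : Obs d => ‖o‖ ^ 4) (i := i)
    h.integrable_pow_four
  have hI : Integrable (fun D : Fin n → Obs d => avg D fun o => ‖o‖ ^ 4)
      (Measure.pi fun _ => P) := by
    simp only [avg]
    exact (integrable_finsetSum _ fun i _ => hint i).const_mul _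
  have hmean : ∫ D : Fin n → Obs d, avg D (fun o => ‖o‖ ^ 4) ∂(Measure.pi fun _ => P)
      = ∫ o, ‖o‖ ^ 4 ∂P := by
    simp only [avg]
    rw [integral_const_mul, integral_finsetSum _ fun i _ => hint i]
    simp only [integral_comp_eval (μ := fun _ : Fin n => P) (f := fun o : Obs d => ‖o‖ ^ 4)
      h.integrable_pow_four.aestronglyMeasurable]
    simp [hn]
  have hmarkov := mul_meas_ge_le_integral_of_nonneg
    (ae_of_all _ fun D : Fin n → Obs d => avg_nonneg D fun o => by positivity) hI K
  rw [hmean, ← le_div_iff₀' hK] at hmarkov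
  calc _ ≤ (Measure.pi fun _ : Fin n => P) {D | K ≤ avg D (fun o => ‖o‖ ^ 4)} :=
        measure_mono fun D (hD : K < _) => hD.le
    _ ≤ ENNReal.ofReal ((∫ o, ‖o‖ ^ 4 ∂P) / K) := by
        rw [← ofReal_measureReal]
        exact ENNReal.ofReal_le_ofReal hmarkov
    _ ≤ _ := ENNReal.ofReal_le_ofReal (by gcongr; exact h.integral_pow_four_le)

end Concentration

/-! ### Events of high probability -/

section HighProbability

variable {d : ℕ}

/-- The event `Q K n P`, about a sample of size `n` from `P`, has probability close to `1` if `K`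
and then `n` are large, uniformly over the family. -/
def WithHighProb (fam : ℕ → Set (ProbabilityMeasure (Obs d)))
    (Q : ℝ → (n : ℕ) → ProbabilityMeasure (Obs d) → (Fin n → Obs d) → Prop) : Prop :=
  ∀ ε : ℝ, 0 < ε → ∀ᶠ K in atTop, ∀ᶠ n in atTop, ∀ P ∈ fam n,
    (Measure.pi fun _ : Fin n => (P : Measure (Obs d))) {D | ¬ Q K n P D} ≤ ENNReal.ofReal ε

variable {fam : ℕ → Set (ProbabilityMeasure (Obs d))}
  {Q Q' : ℝ → (n : ℕ) → ProbabilityMeasure (Obs d) → (Fin n → Obs d) → Prop}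

theorem WithHighProb.mono (h : WithHighProb fam Q)
    (hQ : ∀ᶠ K in atTop, ∀ᶠ n in atTop, ∀ P ∈ fam n, ∀ D, Q K n P D → Q' K n P D) :
    WithHighProb fam Q' := by
  intro ε hε
  filter_upwards [h ε hε, hQ] with K h1 h2
  filter_upwards [h1, h2] with n h3 h4 P hP
  refine le_trans (measure_mono fun D hD => ?_) (h3 P hP)
  exact fun hQD => hD (h4 P hP D hQD)

theorem WithHighProb.and (h : WithHighProb fam Q) (h' : WithHighProb fam Q') :
    WithHighProb fam (fun K n P D => Q K n P D ∧ Q' K n P D) := by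
  intro ε hε
  filter_upwards [h (ε / 2) (by positivity), h' (ε / 2) (by positivity)] with K h1 h2
  filter_upwards [h1, h2] with n h3 h4 P hP
  calc _ ≤ (Measure.pi fun _ : Fin n => (P : Measure (Obs d)))
        ({D | ¬ Q K n P D} ∪ {D | ¬ Q' K n P D}) := by
        refine measure_mono fun D hD => ?_
        by_cases hQ : Q K n P D
        · exact Or.inr fun hQ' => hD ⟨hQ, hQ'⟩
        · exact Or.inl hQ
    _ ≤ ENNReal.ofReal (ε / 2) + ENNReal.ofReal (ε / 2) :=
        (measure_union_le _ _).trans (add_le_add (h3 P hP) (h4 P hP))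
    _ = ENNReal.ofReal ε := by
        rw [← ENNReal.ofReal_add (by positivity) (by positivity), add_halves]

theorem WithHighProb.forall {ι : Type*} [Fintype ι]
    {R : ι → ℝ → (n : ℕ) → ProbabilityMeasure (Obs d) → (Fin n → Obs d) → Prop}
    (h : ∀ j, WithHighProb fam (R j)) : WithHighProb fam (fun K n P D => ∀ j, R j K n P D) := by
  intro ε hε
  -- The `+ 1` covers an empty index type.
  have hε' : 0 < ε / (Fintype.card ι + 1) := by positivity
  have h1 : ∀ᶠ K in atTop, ∀ j, ∀ᶠ n in atTop, ∀ P ∈ fam n,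
      (Measure.pi fun _ : Fin n => (P : Measure (Obs d))) {D | ¬ R j K n P D}
        ≤ ENNReal.ofReal (ε / (Fintype.card ι + 1)) :=
    eventually_all.2 fun j => h j _ hε'
  filter_upwards [h1] with K h2
  filter_upwards [eventually_all.2 h2] with n h3 P hP
  calc _ ≤ (Measure.pi fun _ : Fin n => (P : Measure (Obs d))) (⋃ j, {D | ¬ R j K n P D}) := by
        refine measure_mono fun D hD => ?_
        obtain ⟨j, hj⟩ := not_forall.1 hD
        exact Set.mem_iUnion.2 ⟨j, hj⟩
    _ ≤ ∑ _j : ι, ENNReal.ofReal (ε / (Fintype.card ι + 1)) :=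
        (measure_iUnion_fintype_le _ _).trans (Finset.sum_le_sum fun j _ => h3 j P hP)
    _ = ENNReal.ofReal (Fintype.card ι * (ε / (Fintype.card ι + 1))) := by
        rw [Finset.sum_const, Finset.card_univ, nsmul_eq_mul,
          ENNReal.ofReal_mul (Nat.cast_nonneg _), ENNReal.ofReal_natCast]
    _ ≤ _ := by
        refine ENNReal.ofReal_le_ofReal ?_
        rw [← mul_div_assoc, div_le_iff₀ (by positivity)]
        nlinarith

variable {δ M A : ℝ} {f : ProbabilityMeasure (Obs d) → Obs d → ℝ}

/-- The law of large numbers. -/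
theorem withHighProb_abs_avg_sub_lt (hmom : ∀ n, ∀ P ∈ fam n, HasMoments δ M (P : Measure (Obs d)))
    (hf : ∀ P, Measurable (f P)) (hA : ∀ n, ∀ P ∈ fam n, ∀ o, |f P o| ≤ A * ‖o‖ ^ 2) {t : ℝ}
    (ht : 0 < t) :
    WithHighProb fam (fun _ _ P D => |avg D (f P) - ∫ o, f P o ∂(P : Measure (Obs d))| < t) := by
  intro ε hε
  refine Eventually.of_forall fun K => ?_
  have hlim : Tendsto (fun n : ℕ => A ^ 2 * M / (n * t ^ 2)) atTop (𝓝 0) :=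
    (tendsto_natCast_atTop_atTop.atTop_mul_const (by positivity)).const_div_atTop _
  filter_upwards [hlim.eventually_le_const hε, eventually_ne_atTop 0] with n h1 h2 P hP
  simp only [not_lt]
  exact ((hmom n P hP).measure_le_abs_avg_sub_le (hf P) (hA n P hP) h2 ht).trans
    (ENNReal.ofReal_le_ofReal h1)

/-- The empirical means converge at the rate `1 / √n`. -/
theorem withHighProb_abs_avg_le (hmom : ∀ n, ∀ P ∈ fam n, HasMoments δ M (P : Measure (Obs d)))
    (hf : ∀ P, Measurable (f P)) (hA : ∀ n, ∀ P ∈ fam n, ∀ o, |f P o| ≤ A * ‖o‖ ^ 2)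
    (hmean : ∀ n, ∀ P ∈ fam n, ∫ o, f P o ∂(P : Measure (Obs d)) = 0) :
    WithHighProb fam (fun K n P D => |avg D (f P)| ≤ K / √n) := by
  intro ε hε
  have hlim : Tendsto (fun K : ℝ => A ^ 2 * M / K ^ 2) atTop (𝓝 0) :=
    (tendsto_pow_atTop two_ne_zero).const_div_atTop _
  filter_upwards [hlim.eventually_le_const hε, eventually_gt_atTop 0] with K h1 h2
  filter_upwards [eventually_ne_atTop 0] with n hn P hP
  have hn0 : (0 : ℝ) < n := by positivity
  have h3 := (hmom n P hP).measure_le_abs_avg_sub_le (hf P) (hA n P hP) hn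
    (t := K / √n) (by positivity)
  rw [hmean n P hP, div_pow, Real.sq_sqrt hn0.le, mul_div_cancel₀ _ hn0.ne'] at h3
  refine (measure_mono fun D hD => ?_).trans (h3.trans (ENNReal.ofReal_le_ofReal h1))
  simp only [sub_zero]
  exact (not_le.1 hD).le

theorem withHighProb_avg_norm_le
    (hmom : ∀ n, ∀ P ∈ fam n, HasMoments δ M (P : Measure (Obs d))) :
    WithHighProb fam (fun K _ _ D => avg D (fun o => ‖o‖ ^ 4) ≤ K) := by
  intro ε hε
  have hlim : Tendsto (fun K : ℝ => M / K) atTop (𝓝 0) := tendsto_id.const_div_atTop _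
  filter_upwards [hlim.eventually_le_const hε, eventually_gt_atTop 0] with K h1 h2
  filter_upwards [eventually_ne_atTop 0] with n hn P hP
  simp only [not_le]
  exact ((hmom n P hP).measure_lt_avg_norm_le hn h2).trans (ENNReal.ofReal_le_ofReal h1)

/-- A Gram matrix that is close to that of the population is well conditioned. -/
theorem HasMoments.le_avg_dotProduct_Z_sq {P : Measure (Obs d)} [IsProbabilityMeasure P]
    {c b : ℝ} {g : Fin d → ℝ} (h : HasMoments δ M P) (hP : NondegeneracyBound c P b g)
    (hc : 0 < c) {n : ℕ} {D : Fin n → Obs d}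
    (hD : ∀ j k, |avg D (fun o => o.Z j * o.Z k) - ∫ o, o.Z j * o.Z k ∂P| < c / (2 * (d + 1)))
    (u : Fin d → ℝ) : c / 2 * ∑ j, u j ^ 2 ≤ avg D (fun o => (u ⬝ᵥ o.Z) ^ 2) := by
  have hI (j k : Fin d) : Integrable (fun o : Obs d => u j * u k * (o.Z j * o.Z k)) P :=
    (h.integrable (by fun_prop) (k := 1 + 1) (by norm_num)
      fun o => abs_mul_le_of_le (abs_Z_le' o j) (abs_Z_le' o k)).const_mul _
  have e (o : Obs d) : (u ⬝ᵥ o.Z) ^ 2 = ∑ j, ∑ k, u j * u k * (o.Z j * o.Z k) := by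
    rw [sq, dotProduct, Finset.sum_mul_sum]
    exact Finset.sum_congr rfl fun i _ => Finset.sum_congr rfl fun j _ => by ring
  have h1 : ∫ o, (u ⬝ᵥ o.Z) ^ 2 ∂P = ∑ j, ∑ k, u j * u k * ∫ o, o.Z j * o.Z k ∂P := by
    simp only [e]
    rw [integral_finsetSum _ fun i _ => integrable_finsetSum _ fun j _ => hI i j]
    refine Finset.sum_congr rfl fun j _ => ?_
    rw [integral_finsetSum _ fun k _ => hI j k]
    exact Finset.sum_congr rfl fun k _ => integral_const_mul _ _
  have h2 : avg D (fun o => (u ⬝ᵥ o.Z) ^ 2)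
      = ∑ j, ∑ k, u j * u k * avg D (fun o => o.Z j * o.Z k) := by
    simp only [e, avg_finset_sum, avg_const_mul]
  have h3 : |avg D (fun o => (u ⬝ᵥ o.Z) ^ 2) - ∫ o, (u ⬝ᵥ o.Z) ^ 2 ∂P|
      ≤ c / (2 * (d + 1)) * (∑ j, |u j|) ^ 2 := by
    rw [h1, h2, ← Finset.sum_sub_distrib, sq, Finset.sum_mul_sum, Finset.mul_sum]
    refine (Finset.abs_sum_le_sum_abs _ _).trans (Finset.sum_le_sum fun j _ => ?_)
    rw [← Finset.sum_sub_distrib, Finset.mul_sum]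
    refine (Finset.abs_sum_le_sum_abs _ _).trans (Finset.sum_le_sum fun k _ => ?_)
    rw [← mul_sub, abs_mul, abs_mul, mul_comm]
    exact mul_le_mul_of_nonneg_right (hD j k).le (by positivity)
  have h4 : (∑ j, |u j|) ^ 2 ≤ d * ∑ j, u j ^ 2 := by
    have := sq_sum_le_card_mul_sum_sq (s := Finset.univ) (f := fun j => |u j|)
    simpa [sq_abs] using this
  have h5 := h.le_integral_dotProduct_Z_sq hP u
  -- The entrywise tolerance was chosen so that passing from the ℓ¹ norm to the ℓ² norm loses
  -- exactly half of `c`; `d + 1` in place of `d` admits `d = 0`.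
  have h6 : c / (2 * (d + 1)) * (∑ j, |u j|) ^ 2 ≤ c / 2 * ∑ j, u j ^ 2 := by
    have hs : 0 ≤ ∑ j, u j ^ 2 := Finset.sum_nonneg fun j _ => sq_nonneg _
    calc _ ≤ c / (2 * (d + 1)) * ((d + 1) * ∑ j, u j ^ 2) := by
          gcongr
          linarith
      _ = _ := by field_simp
  have h7 := (abs_le.1 h3).1
  linarith

variable {β : ProbabilityMeasure (Obs d) → ℝ} {γ : ProbabilityMeasure (Obs d) → Fin d → ℝ}

/-- The sample variance of the score is bounded below with high probability. -/
theorem withHighProb_variance_score {c : ℝ} (hδ : 0 < δ) (hc : 0 < c)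
    (hmom : ∀ n, ∀ P ∈ fam n, HasMoments δ M (P : Measure (Obs d)))
    (hmodel : ∀ n, ∀ P ∈ fam n, IsLinearModel (P : Measure (Obs d)) (β P) (γ P))
    (hnondeg : ∀ n, ∀ P ∈ fam n, NondegeneracyBound c (P : Measure (Obs d)) (β P) (γ P))
    (hbdd : ∀ n, ∀ P ∈ fam n, IsBoundedModel A (P : Measure (Obs d)) (β P) (γ P)) :
    WithHighProb fam (fun _ _ P D => c ^ 2 / 8
      ≤ avg D (fun o => score P (β P) (γ P) o ^ 2) - avg D (score P (β P) (γ P)) ^ 2) := by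
  obtain ⟨r, hr, hrδ⟩ : ∃ r : ℝ, 0 < r ∧ (A ^ 2 * (A + 1)) ^ 2 * M ≤ c ^ 2 / 4 * r ^ δ := by
    have hlim := (tendsto_rpow_atTop hδ).const_mul_atTop (show 0 < c ^ 2 / 4 by positivity)
    exact ((eventually_gt_atTop 0).and (hlim.eventually_ge_atTop _)).exists
  -- The absolute value is needed because `0 ≤ A` follows only from a member of the family, which
  -- may be empty.
  set B := |A ^ 2 * (A + 1) * r ^ 2| with hB
  have hB0 : 0 ≤ B := abs_nonneg _
  -- An error `t` in the first two empirical moments moves the variance by at most `t + t (2 B + t)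
  -- ≤ t (2 + 2 B) ≤ c ^ 2 / 8`.
  set t := min 1 (c ^ 2 / (16 * (1 + B))) with ht
  have ht0 : 0 < t := lt_min one_pos (by positivity)
  have hm (P : ProbabilityMeasure (Obs d)) :
      Measurable fun o => clip B (score (P : Measure (Obs d)) (β P) (γ P) o) :=
    (measurable_clip B).comp (measurable_score _ _ _)
  have hle : ∀ n, ∀ P ∈ fam n, ∀ o, |clip B (score (P : Measure (Obs d)) (β P) (γ P) o)|
      ≤ A ^ 2 * (A + 1) * ‖o‖ ^ 2 := fun n P hP o =>
    (abs_clip_le_abs hB0 _).trans ((hbdd n P hP).abs_score_le o)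
  have w1 := withHighProb_abs_avg_sub_lt hmom hm hle ht0
  -- The squared truncated score is at most `B` times its modulus, so it grows only quadratically in
  -- the norm. This is what truncation buys.
  have w2 := withHighProb_abs_avg_sub_lt (A := B * (A ^ 2 * (A + 1))) hmom
    (fun P => (hm P).pow_const 2) (fun n P hP o => by
      rw [sq, abs_mul, mul_assoc]
      exact mul_le_mul (abs_clip_le hB0 _) (hle n P hP o) (abs_nonneg _) hB0) ht0
  refine (w1.and w2).mono (Eventually.of_forall fun K => ?_)
  filter_upwards [eventually_ne_atTop 0] with n hn P hP D ⟨hD1, hD2⟩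
  refine le_trans ?_ (avg_clip_sq_sub_le hn D _ B)
  have hA := (hbdd n P hP).nonneg
  have hpop := (hmom n P hP).le_variance_clip_score hδ hc (hnondeg n P hP) (hmodel n P hP)
    (hbdd n P hP) hr hrδ
  rw [← abs_of_nonneg (show 0 ≤ A ^ 2 * (A + 1) * r ^ 2 by positivity), ← hB] at hpop
  have hmean : |∫ o, clip B (score (P : Measure (Obs d)) (β P) (γ P) o) ∂(P : Measure (Obs d))|
      ≤ B := by
    have := norm_integral_le_of_norm_le_const (μ := (P : Measure (Obs d)))
      (f := fun o => clip B (score (P : Measure (Obs d)) (β P) (γ P) o)) (C := B)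
      (ae_of_all _ fun o => abs_clip_le hB0 (score (P : Measure (Obs d)) (β P) (γ P) o))
    simpa using this
  set a := avg D fun o => clip B (score (P : Measure (Obs d)) (β P) (γ P) o)
  set m := ∫ o, clip B (score (P : Measure (Obs d)) (β P) (γ P) o) ∂(P : Measure (Obs d))
  have h1 : a ^ 2 - m ^ 2 ≤ t * (2 * B + t) := by
    have e : a ^ 2 - m ^ 2 = (a - m) * (a - m + 2 * m) := by ring
    rw [e]
    refine (le_abs_self _).trans ?_
    rw [abs_mul]
    refine mul_le_mul hD1.le ((abs_add_le _ _).trans ?_) (abs_nonneg _) ht0.le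
    rw [abs_mul, abs_two]
    linarith
  have h2 : t * (2 + 2 * B) ≤ c ^ 2 / 8 := by
    have := min_le_right 1 (c ^ 2 / (16 * (1 + B)))
    rw [← ht, le_div_iff₀ (by positivity)] at this
    linarith
  have h3 : t * (2 * B + t) ≤ t * (2 * B + 1) := by
    gcongr
    exact min_le_left _ _
  have h4 := (abs_lt.1 hD2).1
  linarith

/-- Samples are regular with high probability. -/
theorem withHighProb_isRegular {c : ℝ} (hδ : 0 < δ) (hc : 0 < c)
    (hmom : ∀ n, ∀ P ∈ fam n, HasMoments δ M (P : Measure (Obs d)))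
    (hmodel : ∀ n, ∀ P ∈ fam n, IsLinearModel (P : Measure (Obs d)) (β P) (γ P))
    (hnondeg : ∀ n, ∀ P ∈ fam n, NondegeneracyBound c (P : Measure (Obs d)) (β P) (γ P)) :
    WithHighProb fam (fun K _ P D => IsRegular c (c ^ 2 / 8) K P (β P) (γ P) D) := by
  have hbdd : ∀ n, ∀ P ∈ fam n,
      IsBoundedModel (modelConst d c M) (P : Measure (Obs d)) (β P) (γ P) :=
    fun n P hP => (hmom n P hP).isBoundedModel hc (hnondeg n P hP) (hmodel n P hP)
  set A := modelConst d c M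
  have hxi : ∀ n, ∀ P ∈ fam n, ∀ o, |xi (P : Measure (Obs d)) o| ≤ A * ‖o‖ ^ 1 :=
    fun n P hP o => by simpa using (hbdd n P hP).abs_xi o
  have hz : ∀ n, ∀ P ∈ fam n, ∀ o : Obs d, |noise (β P) (γ P) o| ≤ A * ‖o‖ ^ 1 :=
    fun n P hP o => by simpa using (hbdd n P hP).abs_noise o
  have gram : WithHighProb fam (fun _ _ P D => ∀ j k : Fin d,
      |avg D (fun o => o.Z j * o.Z k) - ∫ o, o.Z j * o.Z k ∂(P : Measure (Obs d))|
        < c / (2 * (d + 1))) :=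
    .forall fun j => .forall fun k => withHighProb_abs_avg_sub_lt
      (f := fun _ o => o.Z j * o.Z k) hmom (fun P => by fun_prop)
      (fun n P hP o => abs_mul_le_of_le (abs_Z_le' o j) (abs_Z_le' o k)) (by positivity)
  have zxi : WithHighProb fam (fun K n P D => ∀ j : Fin d,
      |avg D (fun o => o.Z j * xi (P : Measure (Obs d)) o)| ≤ K / √n) :=
    .forall fun j => withHighProb_abs_avg_le (f := fun P o => o.Z j * xi (P : Measure (Obs d)) o)
      hmom (fun P => by fun_prop)
      (fun n P hP o => abs_mul_le_of_le (abs_Z_le' o j) (hxi n P hP o))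
      fun n P hP => (hmom n P hP).integral_Z_mul_xi (hnondeg n P hP) j
  have znoise : WithHighProb fam (fun K n P D => ∀ j : Fin d,
      |avg D (fun o => o.Z j * noise (β P) (γ P) o)| ≤ K / √n) :=
    .forall fun j => withHighProb_abs_avg_le (f := fun P o => o.Z j * noise (β P) (γ P) o)
      hmom (fun P => by fun_prop)
      (fun n P hP o => abs_mul_le_of_le (abs_Z_le' o j) (hz n P hP o))
      fun n P hP => (hmodel n P hP).integral_mul_noise
        (measurable_sigmaXZ (F := fun w => w.2 j) (by fun_prop))
        ((hmom n P hP).integrable (by fun_prop) (k := 1 + 1) (by norm_num)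
          fun o => abs_mul_le_of_le (abs_Z_le' o j) (hz n P hP o))
  have xinoise : WithHighProb fam (fun K n P D =>
      |avg D (fun o => xi (P : Measure (Obs d)) o * noise (β P) (γ P) o)| ≤ K / √n) :=
    withHighProb_abs_avg_le (f := fun P o => xi (P : Measure (Obs d)) o * noise (β P) (γ P) o)
      hmom (fun P => by fun_prop)
      (fun n P hP o => abs_mul_le_of_le (hxi n P hP o) (hz n P hP o))
      fun n P hP => (hmodel n P hP).integral_mul_noise (measurable_sigmaXZ_xi _)
        ((hmom n P hP).integrable (by fun_prop) (k := 1 + 1) (by norm_num)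
          fun o => abs_mul_le_of_le (hxi n P hP o) (hz n P hP o))
  have xisq := withHighProb_abs_avg_sub_lt (fam := fam) (t := c / 2)
    (f := fun P o => xi (P : Measure (Obs d)) o ^ 2) (A := A * A) hmom (fun P => by fun_prop)
    (fun n P hP o => by
      rw [sq (xi _ o)]
      exact abs_mul_le_of_le (hxi n P hP o) (hxi n P hP o)) (by positivity)
  have var := withHighProb_variance_score hδ hc hmom hmodel hnondeg hbdd
  have norm := withHighProb_avg_norm_le hmom
  refine (gram.and (zxi.and (znoise.and (xinoise.and (xisq.and (norm.and var)))))).mono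
    (Eventually.of_forall fun K => Eventually.of_forall fun n P hP D => ?_)
  rintro ⟨h1, h2, h3, h4, h5, h6, h7⟩
  refine ⟨(hmom n P hP).le_avg_dotProduct_Z_sq (hnondeg n P hP) hc h1, h2, h3, h4, ?_, h6, h7⟩
  have := (hnondeg n P hP).le_integral_xi_sq
  linarith [(abs_lt.1 h5).1]

end HighProbability

/-! ### Uniform power of the test -/

section Power

variable {d : ℕ}

/-- The power at `P` is at least `1 - 2 ε` if two samples in a set of probability at least `1 - ε`
lead to rejection. -/
theorem ofReal_le_power {ols : OLS} {α ε : ℝ} {n : ℕ} {P : ProbabilityMeasure (Obs d)}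
    (hε : 0 ≤ ε) {Q : (Fin n → Obs d) → Prop}
    (hQ : (Measure.pi fun _ : Fin n => (P : Measure (Obs d))) {D | ¬ Q D} ≤ ENNReal.ofReal ε)
    (hT : ∀ D₁ D₂, Q D₁ → Q D₂ → normalQuantile (1 - α) < T ols D₁ D₂) :
    ENNReal.ofReal (1 - 2 * ε) ≤ power ols α n P := by
  set μ := Measure.pi fun _ : Fin n => (P : Measure (Obs d)) with hμ
  set S := {D : (Fin n → Obs d) × (Fin n → Obs d) | normalQuantile (1 - α) < T ols D.1 D.2}
  have hsub : Sᶜ ⊆ ({D | ¬ Q D} ×ˢ Set.univ) ∪ (Set.univ ×ˢ {D | ¬ Q D}) := by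
    intro D hD
    by_cases h1 : Q D.1
    · exact Or.inr ⟨Set.mem_univ _, fun h2 => hD (hT _ _ h1 h2)⟩
    · exact Or.inl ⟨h1, Set.mem_univ _⟩
  have hcompl : (μ.prod μ) Sᶜ ≤ ENNReal.ofReal (2 * ε) := by
    calc _ ≤ _ := measure_mono hsub
      _ ≤ _ := measure_union_le _ _
      _ ≤ ENNReal.ofReal ε + ENNReal.ofReal ε := by
        rw [Measure.prod_prod, Measure.prod_prod, measure_univ, mul_one, one_mul]
        exact add_le_add hQ hQ
      _ = _ := by rw [← ENNReal.ofReal_add hε hε, two_mul]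
  -- The version of least squares is arbitrary, so `S` need not be measurable; subadditivity
  -- replaces the complement rule.
  have huniv : 1 ≤ (μ.prod μ) S + (μ.prod μ) Sᶜ := by
    rw [← measure_univ (μ := μ.prod μ), ← Set.union_compl_self S]
    exact measure_union_le _ _
  rw [ENNReal.ofReal_sub _ (by positivity), ENNReal.ofReal_one]
  exact tsub_le_iff_right.2 (huniv.trans (add_le_add le_rfl hcompl))

/-- The test of nominal level `α` has power tending to `1` uniformly over the alternatives. -/
theorem tendsto_worstPower (fam : ℕ → Set (ProbabilityMeasure (Obs d)))
    (β : ProbabilityMeasure (Obs d) → ℝ)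
    (γ : ProbabilityMeasure (Obs d) → Fin d → ℝ)
    (hmodel : ∀ n, ∀ P ∈ fam n, IsLinearModel (P : Measure (Obs d)) (β P) (γ P))
    (hmoment : ∃ C > (0 : ℝ), ∃ δ > (0 : ℝ), ∀ n, ∀ P ∈ fam n,
      MomentBound C δ (P : Measure (Obs d)))
    (hnondeg : ∃ c > (0 : ℝ), ∀ n, ∀ P ∈ fam n,
      NondegeneracyBound c (P : Measure (Obs d)) (β P) (γ P))
    (ols : OLS) (α : ℝ) :
    Tendsto (fun κ : ℝ => liminf (fun n : ℕ => worstPower ols α (fam n) β n κ) atTop)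
      atTop (𝓝 1) ∧
    Tendsto (fun κ : ℝ => limsup (fun n : ℕ => worstPower ols α (fam n) β n κ) atTop)
      atTop (𝓝 1) := by
  obtain ⟨C, hC, δ, hδ, hmoment⟩ := hmoment
  obtain ⟨c, hc, hnondeg⟩ := hnondeg
  have hmom : ∀ n, ∀ P ∈ fam n, HasMoments δ (1 + 3 * C) (P : Measure (Obs d)) :=
    fun n P hP => (hmoment n P hP).hasMoments hC hδ
  have hreg := withHighProb_isRegular hδ hc hmom hmodel hnondeg
  have hle (n : ℕ) (κ : ℝ) : worstPower ols α (fam n) β n κ ≤ 1 := inf_le_left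
  have hsup (κ : ℝ) : limsup (fun n : ℕ => worstPower ols α (fam n) β n κ) atTop ≤ 1 :=
    limsup_le_of_le (h := Eventually.of_forall fun n => hle n κ)
  have hinf (κ : ℝ) : liminf (fun n : ℕ => worstPower ols α (fam n) β n κ) atTop
      ≤ limsup (fun n : ℕ => worstPower ols α (fam n) β n κ) atTop := liminf_le_limsup
  have hpow : ∀ a < (1 : ℝ≥0∞), ∀ᶠ κ : ℝ in atTop,
      a < liminf (fun n : ℕ => worstPower ols α (fam n) β n κ) atTop := by
    intro a ha
    have ha' : a.toReal < 1 := by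
      rw [← ENNReal.toReal_one]
      exact ENNReal.toReal_strict_mono ENNReal.one_ne_top ha
    -- With this choice `1 - 2 ε` is the midpoint of `a` and `1`.
    set ε := (1 - a.toReal) / 4 with hεdef
    have hε : 0 < ε := by
      rw [hεdef]
      linarith
    -- Regularity does not involve `κ`, so `K` is fixed by `ε` first, and the thresholds for `κ` and
    -- `n` may depend on it.
    obtain ⟨K, hK⟩ := (hreg ε hε).exists
    obtain ⟨κ₀, n₀, hT⟩ := exists_forall_lt_T d ols (K := K) (A := modelConst d c (1 + 3 * C)) hc
      (show 0 < c ^ 2 / 8 by positivity) (normalQuantile (1 - α))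
    filter_upwards [eventually_ge_atTop κ₀] with κ hκ
    have h1 : a < ENNReal.ofReal (1 - 2 * ε) := by
      rw [ENNReal.lt_ofReal_iff_toReal_lt ha.ne_top]
      linarith
    refine h1.trans_le (le_liminf_of_le (h := ?_))
    filter_upwards [hK, eventually_ge_atTop n₀] with n hn hn₀
    refine le_inf (ENNReal.ofReal_le_one.2 (by linarith)) (le_iInf₂ fun P hP => ?_)
    exact ofReal_le_power hε.le (hn P hP.1) fun D₁ D₂ hD₁ hD₂ => hT κ hκ n hn₀ P (β P) (γ P) D₁ D₂
      ((hmom n P hP.1).isBoundedModel hc (hnondeg n P hP.1) (hmodel n P hP.1)) hD₁ hD₂ hP.2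
  constructor
  · refine tendsto_order.2 ⟨hpow, fun a ha => Eventually.of_forall fun κ => ?_⟩
    exact ((hinf κ).trans (hsup κ)).trans_lt ha
  · refine tendsto_order.2 ⟨fun a ha => ?_, fun a ha => Eventually.of_forall fun κ => ?_⟩
    · filter_upwards [hpow a ha] with κ hκ
      exact hκ.trans_le (hinf κ)
    · exact (hsup κ).trans_lt ha

end Power

end PCM

end

theorem mainTheorem9 {d : ℕ}
    -- the family of distributions, which may vary with the sample size,
    -- and the regression coefficients of its members
    (fam : ℕ → Set (ProbabilityMeasure (Obs d)))
    (β : ProbabilityMeasure (Obs d) → ℝ)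
    (γ : ProbabilityMeasure (Obs d) → Fin d → ℝ)
    (hmodel : ∀ n, ∀ P ∈ fam n, PCM.IsLinearModel (P : Measure (Obs d)) (β P) (γ P))
    (hmoment : ∃ C > (0 : ℝ), ∃ δ > (0 : ℝ), ∀ n, ∀ P ∈ fam n,
      PCM.MomentBound C δ (P : Measure (Obs d)))
    (hnondeg : ∃ c > (0 : ℝ), ∀ n, ∀ P ∈ fam n,
      PCM.NondegeneracyBound c (P : Measure (Obs d)) (β P) (γ P))
    (ols : PCM.OLS) (α : ℝ) (hα : 0 < α) (hα' : α < 1) :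
    Tendsto (fun κ : ℝ => liminf (fun n : ℕ => PCM.worstPower ols α (fam n) β n κ) atTop)
      atTop (𝓝 1) ∧
    Tendsto (fun κ : ℝ => limsup (fun n : ℕ => PCM.worstPower ols α (fam n) β n κ) atTop)
      atTop (𝓝 1) :=
  PCM.tendsto_worstPower fam β γ hmodel hmoment hnondeg ols α
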